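/- Let $(W,S)$ be a Coxeter system with $S$ finite and Coxeter matrix $(m(s,t))_{s,t\in S}$, $m(s,t)\in\{1,2,3,\dots\}\cup\{\infty\}$. Assume that it is irreducible, i.e. that its Coxeter graph (vertex set $S$, distinct $s,t$ joined when $m(s,t)\ge 3$, including $m(s,t)=\infty$) is connected, and that $W$ is neither finite nor affine, where affine means infinite with a subgroup of finite index isomorphic to $\mathbf Z^d$ for some $d\ge 1$. Let $B_S$ be the Tits form on $E=\mathbf R^S$, i.e. the symmetric bilinear form with $B_S(e_s,e_t)=-\cos(\pi/m(s,t))$, read as $-1$ when $m(s,t)=\infty$. Let $\operatorname{Of}(B_S)$ be the group of all $g\in\operatorname{GL}(E)$ that preserve $B_S$ and fix every vector of $\ker(B_S)=\{v\in E: B_S(v,w)=0\ \forall w\in E\}$, and let $$\mathfrak{of}(B_S)=\{X\in\operatorname{End}(E): B_S(Xv,w)+B_S(v,Xw)=0\ \ \forall v,w\in E,\ \ Xv=0\ \ \forall v\in\ker(B_S)\}$$ be its (real) Lie algebra. Let $p$ (respectively $q$) be the maximal dimension of a subspace of $E$ on which $B_S$ is positive (respectively negative) definite, and let $r=\dim\ker(B_S)$.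 Then: 1. $\mathfrak{of}(B_S)\cong(\mathbf R^{p+q})^r\rtimes\mathfrak{so}(p,q)$ as real Lie algebras, where $(\mathbf R^{p+q})^r$ is an abelian Lie algebra on which $\mathfrak{so}(p,q)$ acts diagonally through its natural action on $\mathbf R^{p+q}$; 2. the real Lie algebra $\mathfrak{so}(p,q)$ is simple, and its natural action on $\mathbf R^{p+q}$ is irreducible; 3. the real Lie algebra $\mathfrak{of}(B_S)$ is not presentable by a product: there do not exist subalgebras $\mathfrak g_1,\mathfrak g_2$ of $\mathfrak{of}(B_S)$, both of positive dimension, with $[X_1,X_2]=0$ for all $X_1\in\mathfrak g_1$, $X_2\in\mathfrak g_2$, such that the map $\mathfrak g_1\times\mathfrak g_2\to\mathfrak{of}(B_S)$, $(X_1,X_2)\mapsto X_1+X_2$, is onto. -/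

import Mathlib

attribute [local instance 100] LieRing.ofAssociativeRing

noncomputable section

/-- A Lie algebra `L` over a field `k` is presentable by a product if it contains two commuting
subalgebras of positive dimension such that the addition map `L₁ × L₂ → L` is onto. -/
def LieIsPresentableByProduct (k L : Type*) [Field k] [LieRing L] [LieAlgebra k L] : Prop :=
  ∃ L₁ L₂ : LieSubalgebra k L, L₁ ≠ ⊥ ∧ L₂ ≠ ⊥ ∧
    (∀ x ∈ L₁, ∀ y ∈ L₂, ⁅x, y⁆ = 0) ∧ ∀ z : L, ∃ x ∈ L₁, ∃ y ∈ L₂, x + y = z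

/-- The group is affine: it is infinite and has a subgroup of finite index isomorphic to `ℤ ^ d`
for some `d ≥ 1`. -/
def IsAffineGroup (W : Type*) [Group W] : Prop :=
  Infinite W ∧ ∃ d : ℕ, 1 ≤ d ∧ ∃ H : Subgroup W,
    H.FiniteIndex ∧ Nonempty (H ≃* Multiplicative (Fin d → ℤ))

namespace CoxeterMatrix

variable {S : Type*}

/-- The Coxeter graph: distinct `s`, `t` are joined when `m(s,t) ≥ 3` or `m(s,t) = ∞`.
(In a `CoxeterMatrix` the value `∞` is encoded by `0`.) -/
def coxeterGraph (M : CoxeterMatrix S) : SimpleGraph S where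
  Adj s t := s ≠ t ∧ M s t ≠ 2
  symm := ⟨fun s t h => ⟨h.1.symm, by rw [M.symmetric]; exact h.2⟩⟩
  loopless := ⟨fun _ h => h.1 rfl⟩

/-- A Coxeter system is irreducible when its Coxeter graph is connected. -/
def IsIrreducible (M : CoxeterMatrix S) : Prop := M.coxeterGraph.Connected

/-- The Gram matrix of the Tits form: `-cos (π / m(s,t))`, and `-1` when `m(s,t) = ∞`. -/
def titsMatrix (M : CoxeterMatrix S) : Matrix S S ℝ :=
  fun s t => if M s t = 0 then -1 else -Real.cos (Real.pi / (M s t : ℝ))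

/-- The Tits form `B_S` on `ℝ ^ S`. -/
def titsForm [Fintype S] [DecidableEq S] (M : CoxeterMatrix S) :
    LinearMap.BilinForm ℝ (S → ℝ) :=
  Matrix.toBilin' M.titsMatrix

end CoxeterMatrix

section Of

variable {E : Type*} [AddCommGroup E] [Module ℝ E]

/-- The group `Of(B)` of linear automorphisms that preserve `B` and fix the kernel of `B`
pointwise. -/
def OfGroup (B : LinearMap.BilinForm ℝ E) : Subgroup (E ≃ₗ[ℝ] E) where
  carrier := {g | (∀ v w, B (g v) (g w) = B v w) ∧ ∀ v ∈ LinearMap.ker B, g v = v}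
  one_mem' := ⟨fun _ _ => rfl, fun _ _ => rfl⟩
  mul_mem' := by
    rintro g h ⟨hg, hg'⟩ ⟨hh, hh'⟩
    refine ⟨fun v w => ?_, fun v hv => ?_⟩
    · rw [LinearEquiv.mul_apply, LinearEquiv.mul_apply, hg, hh]
    · rw [LinearEquiv.mul_apply, hh' v hv, hg' v hv]
  inv_mem' := by
    rintro g ⟨hg, hg'⟩
    have key : ∀ v, g (g⁻¹ v) = v := fun v => g.apply_symm_apply v
    refine ⟨fun v w => ?_, fun v hv => ?_⟩
    · rw [← hg, key, key]
    · apply g.injective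
      rw [key, hg' v hv]

/-- The Lie algebra `𝔬𝔣(B)` of the linear group `Of(B)`: the endomorphisms that are skew for `B`
and vanish on the kernel of `B`. That this is the Lie algebra of `Of(B)`, i.e. the set of `X` such
that `exp (t X)` lies in `Of(B)` for all real `t`, is proved in `mem_ofLie_iff_exp`. -/
def ofLie (B : LinearMap.BilinForm ℝ E) : LieSubalgebra ℝ (Module.End ℝ E) where
  carrier := {X | (∀ v w, B (X v) w + B v (X w) = 0) ∧ ∀ v ∈ LinearMap.ker B, X v = 0}
  zero_mem' := by simp
  add_mem' := by
    rintro X Y ⟨hX, hX'⟩ ⟨hY, hY'⟩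
    refine ⟨fun v w => ?_, fun v hv => ?_⟩
    · have h1 := hX v w
      have h2 := hY v w
      simp only [LinearMap.add_apply, map_add]
      linarith
    · simp [hX' v hv, hY' v hv]
  smul_mem' := by
    rintro c X ⟨hX, hX'⟩
    refine ⟨fun v w => ?_, fun v hv => ?_⟩
    · have h1 := hX v w
      simp only [LinearMap.smul_apply, map_smul, smul_eq_mul]
      rw [← mul_add, h1, mul_zero]
    · simp [hX' v hv]
  lie_mem' := by
    rintro X Y ⟨hX, hX'⟩ ⟨hY, hY'⟩
    refine ⟨fun v w => ?_, fun v hv => ?_⟩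
    · have h1 := hX (Y v) w
      have h2 := hY v (X w)
      have h3 := hY (X v) w
      have h4 := hX v (Y w)
      simp only [Ring.lie_def, Module.End.mul_apply, LinearMap.sub_apply, map_sub]
      linarith
    · simp [Ring.lie_def, hX' v hv, hY' v hv]

end Of

section Exp

variable {n : Type*} [Fintype n] [DecidableEq n]

theorem ofLie_exp_aux (B X : Matrix n n ℝ) (h : X.transpose * B = B * (-X)) :
    (NormedSpace.exp X).transpose * B * NormedSpace.exp X = B := by
  let _ : NormedRing (Matrix n n ℝ) := Matrix.linftyOpNormedRing
  let _ : NormedAlgebra ℝ (Matrix n n ℝ) := Matrix.linftyOpNormedAlgebra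
  let _ : NormedAlgebra ℚ (Matrix n n ℝ) := NormedAlgebra.restrictScalars ℚ ℝ _
  have h1 : SemiconjBy B (-X) X.transpose := h.symm
  have h2 : B * NormedSpace.exp (-X) = NormedSpace.exp X.transpose * B := h1.exp_right
  rw [← Matrix.exp_transpose, ← h2, mul_assoc,
    ← Matrix.exp_add_of_commute _ _ (Commute.refl X).neg_left, neg_add_cancel,
    NormedSpace.exp_zero, mul_one]

theorem ofLie_exp_fix_aux (X : Matrix n n ℝ) (v : n → ℝ) (h : X.mulVec v = 0) :
    (NormedSpace.exp X).mulVec v = v := by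
  let _ : NormedRing (Matrix n n ℝ) := Matrix.linftyOpNormedRing
  let _ : NormedAlgebra ℝ (Matrix n n ℝ) := Matrix.linftyOpNormedAlgebra
  let _ : NormedAlgebra ℚ (Matrix n n ℝ) := NormedAlgebra.restrictScalars ℚ ℝ _
  have h1 : SemiconjBy (Matrix.vecMulVec v v) 0 X := by
    unfold SemiconjBy
    rw [mul_zero, Matrix.mul_vecMulVec, h, Matrix.zero_vecMulVec]
  have h2 := h1.exp_right
  unfold SemiconjBy at h2
  rw [NormedSpace.exp_zero, mul_one, Matrix.mul_vecMulVec] at h2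
  funext i
  by_cases hv : v = 0
  · simp [hv]
  · obtain ⟨j, hj⟩ := Function.ne_iff.mp hv
    have h3 := congrFun (congrFun h2 i) j
    simp only [Matrix.vecMulVec_apply] at h3
    exact (mul_right_cancel₀ hj h3).symm

/-- `𝔬𝔣(B)` is the Lie algebra of the linear group `Of(B)`. -/
theorem mem_ofLie_iff_exp (B : LinearMap.BilinForm ℝ (n → ℝ)) (X : Module.End ℝ (n → ℝ)) :
    X ∈ ofLie B ↔ ∀ t : ℝ, ∃ g ∈ OfGroup B,
      LinearMap.toMatrix' (g : (n → ℝ) →ₗ[ℝ] (n → ℝ)) =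
        NormedSpace.exp (t • LinearMap.toMatrix' X) := by
  generalize hA : LinearMap.toMatrix' X = A
  have hXA : ∀ v, X v = A.mulVec v := fun v => by
    rw [← hA, LinearMap.toMatrix'_mulVec]
  generalize hG : LinearMap.BilinForm.toMatrix' B = G
  have hBG : ∀ v w, B v w = v ⬝ᵥ G.mulVec w := fun v w => by
    rw [← hG, ← Matrix.toBilin'_apply', Matrix.toBilin'_toMatrix']
  have pres : ∀ P Q : Matrix n n ℝ, (∀ v w, B (P.mulVec v) w = B v (Q.mulVec w)) ↔
      P.transpose * G = G * Q := by
    intro P Q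
    simp only [hBG]
    constructor
    · intro h
      ext i j
      have h1 := h (Pi.single i 1) (Pi.single j 1)
      rw [← Matrix.vecMul_transpose, ← Matrix.dotProduct_mulVec, Matrix.mulVec_mulVec,
        Matrix.mulVec_mulVec] at h1
      simpa using h1
    · intro h v w
      rw [← Matrix.vecMul_transpose, ← Matrix.dotProduct_mulVec, Matrix.mulVec_mulVec,
        Matrix.mulVec_mulVec, h]
  constructor
  · rintro ⟨h1, h2⟩ t
    have hs : A.transpose * G = G * (-A) := by
      rw [← pres]
      intro v w
      have := h1 v w
      rw [hXA, hXA] at this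
      rw [Matrix.neg_mulVec, map_neg]
      linarith
    have hst : (t • A).transpose * G = G * (-(t • A)) := by
      rw [Matrix.transpose_smul, Matrix.smul_mul, hs, Matrix.mul_neg, Matrix.mul_neg,
        smul_neg, Matrix.mul_smul]
    have hinv : NormedSpace.exp (t • A) * NormedSpace.exp (-(t • A)) = 1 := by
      rw [← Matrix.exp_add_of_commute _ _ (Commute.refl (t • A)).neg_right, add_neg_cancel,
        NormedSpace.exp_zero]
    have hexp := ofLie_exp_aux G (t • A) hst
    refine ⟨Matrix.toLin'OfInv (mul_eq_one_comm.mp hinv) hinv, ⟨?_, ?_⟩, ?_⟩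
    · intro v w
      change B (Matrix.toLin' _ v) (Matrix.toLin' _ w) = B v w
      rw [Matrix.toLin'_apply, Matrix.toLin'_apply, hBG, hBG, ← Matrix.vecMul_transpose,
        ← Matrix.dotProduct_mulVec, Matrix.mulVec_mulVec, Matrix.mulVec_mulVec, hexp]
    · intro v hv
      change Matrix.toLin' _ v = v
      rw [Matrix.toLin'_apply]
      apply ofLie_exp_fix_aux
      rw [Matrix.smul_mulVec, ← hXA, h2 v hv, smul_zero]
    · change LinearMap.toMatrix' (Matrix.toLin' _) = _
      rw [LinearMap.toMatrix'_toLin']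
  · intro h
    let _ : NormedRing (Matrix n n ℝ) := Matrix.linftyOpNormedRing
    let _ : NormedAlgebra ℝ (Matrix n n ℝ) := Matrix.linftyOpNormedAlgebra
    let _ : NormedAlgebra ℚ (Matrix n n ℝ) := NormedAlgebra.restrictScalars ℚ ℝ _
    have hd : ∀ Y : Matrix n n ℝ, HasDerivAt (fun t : ℝ => NormedSpace.exp (t • Y)) Y 0 := by
      intro Y
      have := hasDerivAt_exp_smul_const (𝕂 := ℝ) Y (0 : ℝ)
      rwa [zero_smul, NormedSpace.exp_zero, one_mul] at this
    have hact : ∀ t : ℝ, ∃ g ∈ OfGroup B, ∀ v, g v = (NormedSpace.exp (t • A)).mulVec v := by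
      intro t
      obtain ⟨g, hg, hgt⟩ := h t
      refine ⟨g, hg, fun v => ?_⟩
      rw [← hgt, LinearMap.toMatrix'_mulVec]
      rfl
    constructor
    · have hc : ∀ t : ℝ, NormedSpace.exp (t • A.transpose) * G * NormedSpace.exp (t • A) = G := by
        intro t
        obtain ⟨g, hg, hgt⟩ := hact t
        rw [← Matrix.transpose_smul, Matrix.exp_transpose]
        ext i j
        have h1 := hg.1 (Pi.single i 1) (Pi.single j 1)
        rw [hgt, hgt, hBG, hBG, ← Matrix.vecMul_transpose, ← Matrix.dotProduct_mulVec,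
          Matrix.mulVec_mulVec, Matrix.mulVec_mulVec] at h1
        simpa [Matrix.mul_assoc] using h1
      have hD := ((hd A.transpose).mul_const G).mul (hd A)
      have hconst : HasDerivAt (fun t : ℝ =>
          NormedSpace.exp (t • A.transpose) * G * NormedSpace.exp (t • A)) 0 0 := by
        simp only [hc]
        exact hasDerivAt_const _ _
      have hz := hD.unique hconst
      rw [zero_smul, zero_smul, NormedSpace.exp_zero, mul_one, one_mul] at hz
      have hs : A.transpose * G = G * (-A) := by
        rw [mul_neg]
        exact eq_neg_of_add_eq_zero_left hz
      intro v w
      have := (pres A (-A)).mpr hs v w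
      rw [hXA, hXA, this, Matrix.neg_mulVec, map_neg, neg_add_cancel]
    · intro v hv
      have hc : ∀ t : ℝ, NormedSpace.exp (t • A) * Matrix.vecMulVec v v =
          Matrix.vecMulVec v v := by
        intro t
        obtain ⟨g, hg, hgt⟩ := hact t
        rw [Matrix.mul_vecMulVec, ← hgt, hg.2 v hv]
      have hD := (hd A).mul_const (Matrix.vecMulVec v v)
      simp only [hc] at hD
      have hz := hD.unique (hasDerivAt_const _ _)
      rw [Matrix.mul_vecMulVec, ← hXA] at hz
      funext i
      by_contra hi
      have hv0 : v ≠ 0 := by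
        rintro rfl
        simp at hi
      obtain ⟨j, hj⟩ := Function.ne_iff.mp hv0
      have h3 := congrFun (congrFun hz i) j
      simp only [Matrix.vecMulVec_apply, Matrix.zero_apply] at h3
      exact (mul_ne_zero hi hj) h3

end Exp

/-- The diagonal action of a Lie algebra `𝔤` of `n × n` real matrices on `(ℝ ^ n) ^ r`, regarded
as an abelian Lie algebra. -/
def diagonalAction {n : Type*} [Fintype n] [DecidableEq n] (r : ℕ)
    (𝔤 : LieSubalgebra ℝ (Matrix n n ℝ)) :
    𝔤 →ₗ⁅ℝ⁆ LieDerivation ℝ (Fin r → n → ℝ) (Fin r → n → ℝ) where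
  toFun A :=
    { toFun := fun f i => (A : Matrix n n ℝ).mulVec (f i)
      map_add' := fun f g => by funext i; simp [Matrix.mulVec_add]
      map_smul' := fun c f => by funext i; simp [Matrix.mulVec_smul]
      leibniz' := fun f g => by
        funext i j; simp [Ring.lie_def, mul_comm] }
  map_add' A A' := by ext f i j; simp [Matrix.add_mulVec]
  map_smul' c A := by ext f i j; simp [Matrix.smul_mulVec]
  map_lie' {A A'} := by
    ext f i j
    simp [Ring.lie_def, Matrix.sub_mulVec]

end

/-! By Sylvester's law, E has a basis in which B_S is diagonal with p entries 1, q entries -1 and r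
entries 0, the last r vectors spanning the kernel. In this basis `ofLie` consists of the block
matrices with rows of blocks (A, 0) and (C, 0), where A is skew for the diagonal form `signs p q`
and C is arbitrary. The rows of C are r copies of the dual of the natural module, which the form
identifies with the natural module; this is part 1 (`semiDirectSumToOfLie_bijective`).

For p + q ≥ 3, simplicity of so(p,q) fails only for p + q = 4 with positive discriminant, that is
for so(4) and so(2,2) (`isSimple_skew`). Hence the heart of the matter is the signature
(`signature_bounds`): q ≥ 1, and either p ≥ 3 or (p,q) = (2,1). In dimension four only so(3,1)
survives.

The bound q ≥ 1 says that a positive semidefinite irreducible Tits form belongs to a finite or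
affine group (`finite_or_isAffineGroup`). Every root has coordinates of one sign, so an element of W
close enough to the identity has no descent and is trivial; therefore bounded sets of roots are
finite, and a definite form gives a finite group. If the form is only semidefinite, its kernel is a
line spanned by a vector δ with positive coordinates. The Tits cone argument shows that there are
finitely many roots modulo δ, so the elements acting trivially modulo δ form a subgroup of finite
index, which embeds into a real vector space and is thus free abelian.

The bound on p comes from connected subgraphs with at most four vertices: a Perron-Frobenius
argument shows that their Gram matrices have at most one nonpositive eigenvalue
(`card_le_sigPos_add_one`).

For part 3, two commuting subalgebras with sum everything project onto ideals of so(p,q). A zero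
projection forces the subalgebra to be zero, since so(p,q) kills no nonzero vector; two full
projections would make so(p,q) abelian. -/

noncomputable section

/-! ### The Tits matrix and the braid relations for simple reflections. -/

namespace CoxeterMatrix

variable {S : Type*} (M : CoxeterMatrix S)

theorem titsMatrix_symm (s t : S) : M.titsMatrix s t = M.titsMatrix t s := by
  simp [titsMatrix, M.symmetric s t]

theorem titsMatrix_diag (s : S) : M.titsMatrix s s = 1 := by
  simp [titsMatrix]

theorem three_le_of_ne {s t : S} (hst : s ≠ t) (h0 : M s t ≠ 0) (h2 : M s t ≠ 2) :
    3 ≤ M s t := by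
  have := M.off_diagonal s t hst
  change M s t ≠ 1 at this
  omega

theorem two_le_of_ne {s t : S} (hst : s ≠ t) (h0 : M s t ≠ 0) : 2 ≤ M s t := by
  have := M.off_diagonal s t hst
  change M s t ≠ 1 at this
  omega

theorem neg_one_le_titsMatrix (s t : S) : -1 ≤ M.titsMatrix s t := by
  unfold titsMatrix
  split_ifs
  · rfl
  · linarith [Real.cos_le_one (Real.pi / (M s t : ℝ))]

theorem titsMatrix_nonpos {s t : S} (hst : s ≠ t) : M.titsMatrix s t ≤ 0 := by
  unfold titsMatrix
  split_ifs with h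
  · norm_num
  · have h2 : (2 : ℝ) ≤ M s t := by exact_mod_cast M.two_le_of_ne hst h
    have := Real.cos_nonneg_of_mem_Icc (x := Real.pi / (M s t : ℝ))
      ⟨by have := Real.pi_pos; have : 0 ≤ Real.pi / (M s t : ℝ) := by positivity
          linarith, by gcongr⟩
    linarith

theorem titsMatrix_neg {s t : S} (h : M.coxeterGraph.Adj s t) : M.titsMatrix s t < 0 := by
  obtain ⟨hst, h2⟩ := h
  unfold titsMatrix
  split_ifs with h
  · norm_num
  · have h3 : (3 : ℝ) ≤ M s t := by exact_mod_cast M.three_le_of_ne hst h h2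
    have hpi := Real.pi_pos
    have h4 : Real.pi / (M s t : ℝ) < Real.pi / 2 := by
      apply div_lt_div_of_pos_left hpi two_pos; linarith
    have := Real.cos_pos_of_mem_Ioo (x := Real.pi / (M s t : ℝ))
      ⟨by have : 0 < Real.pi / (M s t : ℝ) := by positivity
          linarith, h4⟩
    linarith

variable [Fintype S] [DecidableEq S]

/-- The simple root `e_s`. -/
def simpleRoot (_M : CoxeterMatrix S) (s : S) : S → ℝ := Pi.single s 1

theorem titsForm_apply (v w : S → ℝ) :
    M.titsForm v w = ∑ s, ∑ t, v s * M.titsMatrix s t * w t := by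
  rw [titsForm, Matrix.toBilin'_apply]

theorem titsForm_simpleRoot_left (s : S) (v : S → ℝ) :
    M.titsForm (M.simpleRoot s) v = ∑ t, M.titsMatrix s t * v t := by
  rw [titsForm_apply, Finset.sum_eq_single s]
  · simp [simpleRoot]
  · intro t _ ht
    simp [simpleRoot, ht]
  · simp

@[simp]
theorem titsForm_simpleRoot (s t : S) :
    M.titsForm (M.simpleRoot s) (M.simpleRoot t) = M.titsMatrix s t := by
  simp [titsForm, simpleRoot]

theorem titsForm_comm (v w : S → ℝ) : M.titsForm v w = M.titsForm w v := by
  rw [titsForm_apply, titsForm_apply, Finset.sum_comm]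
  refine Finset.sum_congr rfl fun s _ => Finset.sum_congr rfl fun t _ => ?_
  rw [M.titsMatrix_symm s t]
  ring

omit [Fintype S] in
theorem simpleRoot_apply (s t : S) : M.simpleRoot s t = if t = s then 1 else 0 := by
  simp [simpleRoot, Pi.single_apply]

theorem eq_sum_simpleRoot (v : S → ℝ) : v = ∑ s, v s • M.simpleRoot s := by
  ext t
  simp [simpleRoot_apply]

/-- The linear form `v ↦ 2 B_S(e_s, v)`. -/
def simpleCoroot (s : S) : Module.Dual ℝ (S → ℝ) := (2 : ℝ) • M.titsForm (M.simpleRoot s)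

theorem simpleCoroot_apply (s : S) (v : S → ℝ) :
    M.simpleCoroot s v = 2 * M.titsForm (M.simpleRoot s) v := rfl

theorem simpleCoroot_self (s : S) : M.simpleCoroot s (M.simpleRoot s) = 2 := by
  rw [simpleCoroot_apply, titsForm_simpleRoot, titsMatrix_diag, mul_one]

/-- The simple reflection `v ↦ v - 2 B_S(e_s, v) e_s`. -/
def simpleRefl (s : S) : (S → ℝ) ≃ₗ[ℝ] (S → ℝ) := Module.reflection (M.simpleCoroot_self s)

theorem simpleRefl_apply (s : S) (v : S → ℝ) :
    M.simpleRefl s v = v - (2 * M.titsForm (M.simpleRoot s) v) • M.simpleRoot s := by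
  rw [simpleRefl, Module.reflection_apply, simpleCoroot_apply]

/-- With θ = π / m, the product of two simple reflections is a rotation by 2θ on their plane. Its
powers are given by the Chebyshev polynomials S evaluated at 2 cos 2θ, and the coefficients of the
m-th power vanish because sin π = 0 (m even) or sin (π + θ) + sin (π - θ) = 0 (m odd). -/
theorem isLiftable_simpleRefl : M.IsLiftable M.simpleRefl := by
  intro s t
  by_cases h0 : M s t = 0
  · rw [h0, pow_zero]
  by_cases hst : s = t
  · subst hst
    rw [M.diagonal, pow_one]
    ext1 v
    exact Module.involutive_reflection _ v
  have h2 := M.two_le_of_ne hst h0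
  set θ : ℝ := Real.pi / (M s t : ℝ) with hθ
  have hm : (M s t : ℝ) ≠ 0 := by exact_mod_cast h0
  have hmθ : (M s t : ℝ) * θ = Real.pi := by rw [hθ]; field_simp
  have hc : M.titsMatrix s t = -Real.cos θ := by simp [titsMatrix, h0, hθ]
  have hc' : M.titsMatrix t s = -Real.cos θ := by rw [titsMatrix_symm, hc]
  have hT : M.simpleCoroot s (M.simpleRoot t) * M.simpleCoroot t (M.simpleRoot s) - 2 =
      2 * Real.cos (2 * θ) := by
    rw [simpleCoroot_apply, simpleCoroot_apply, titsForm_simpleRoot, titsForm_simpleRoot, hc, hc',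
      Real.cos_two_mul]
    ring
  refine LinearEquiv.ext fun z => ?_
  rw [simpleRefl, simpleRefl, Module.reflection_mul_reflection_pow_apply, hT]
  -- For m = 2 one has sin 2θ = 0, so the quotient formula for S is not available and this case is
  -- computed directly.
  rcases h2.eq_or_lt with h | h3
  · rw [← h] at hmθ ⊢
    have h1 : (2 : ℝ) * θ = Real.pi := by exact_mod_cast hmθ
    have hcos : Real.cos θ = 0 := by
      rw [show θ = Real.pi / 2 by linarith, Real.cos_pi_div_two]
    rw [h1, Real.cos_pi]
    simp only [simpleCoroot_apply, titsForm_simpleRoot, hc, hc', hcos]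
    norm_num [Polynomial.Chebyshev.S_neg_one]
    module
  · have hpi := Real.pi_pos
    have hm3 : (3 : ℝ) ≤ M s t := by exact_mod_cast h3
    have hθ0 : 0 < θ := by positivity
    have hsin : Real.sin (2 * θ) ≠ 0 := by
      apply ne_of_gt
      apply Real.sin_pos_of_pos_of_lt_pi (by positivity)
      nlinarith
    have hS : ∀ n : ℤ, (Polynomial.Chebyshev.S ℝ n).eval (2 * Real.cos (2 * θ)) =
        Real.sin ((n + 1) * (2 * θ)) / Real.sin (2 * θ) := fun n => by
      rw [← Polynomial.Chebyshev.S_two_mul_real_cos, mul_div_cancel_right₀ _ hsin]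
    rcases Nat.even_or_odd' (M s t) with ⟨j, hj | hj⟩
    · have e1 : ((M s t : ℤ) - 2) / 2 = j - 1 := by omega
      have e2 : ((M s t : ℤ) - 1) / 2 = j - 1 := by omega
      have z : (Polynomial.Chebyshev.S ℝ ((j : ℤ) - 1)).eval (2 * Real.cos (2 * θ)) = 0 := by
        rw [hS]
        have : (((j : ℤ) - 1 : ℤ) + 1 : ℝ) * (2 * θ) = Real.pi := by
          rw [← hmθ, hj]; push_cast; ring
        rw [this, Real.sin_pi, zero_div]
      rw [e1, e2, z]
      simp
    · have e1 : ((M s t : ℤ) - 2) / 2 = j - 1 := by omega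
      have e2 : ((M s t : ℤ) - 1) / 2 = j := by omega
      have e3 : ((M s t : ℤ) - 3) / 2 = j - 1 := by omega
      have e4 : (M s t : ℤ) / 2 = j := by omega
      have z : (Polynomial.Chebyshev.S ℝ (j : ℤ)).eval (2 * Real.cos (2 * θ)) +
          (Polynomial.Chebyshev.S ℝ ((j : ℤ) - 1)).eval (2 * Real.cos (2 * θ)) = 0 := by
        rw [hS, hS]
        have a1 : (((j : ℤ) : ℝ) + 1) * (2 * θ) = Real.pi + θ := by
          rw [← hmθ, hj]; push_cast; ring
        have a2 : ((((j : ℤ) - 1 : ℤ) : ℝ) + 1) * (2 * θ) = Real.pi - θ := by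
          rw [← hmθ, hj]; push_cast; ring
        rw [a1, a2, Real.sin_add, Real.sin_sub, Real.sin_pi]
        ring
      rw [e1, e2, e3, e4, z]
      simp

end CoxeterMatrix

/-! ### The geometric representation, the sign of roots and faithfulness. -/

namespace CoxeterSystem

variable {S W : Type*} [Fintype S] [DecidableEq S] [Group W] {M : CoxeterMatrix S}
  (cs : CoxeterSystem M W)

/-- The geometric representation of a Coxeter group. -/
def geomRep : W →* ((S → ℝ) ≃ₗ[ℝ] (S → ℝ)) := cs.lift ⟨M.simpleRefl, M.isLiftable_simpleRefl⟩

@[simp]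
theorem geomRep_simple (s : S) : cs.geomRep (cs.simple s) = M.simpleRefl s :=
  cs.lift_apply_simple M.isLiftable_simpleRefl s

theorem geomRep_mul_apply (w w' : W) (v : S → ℝ) :
    cs.geomRep (w * w') v = cs.geomRep w (cs.geomRep w' v) := by
  rw [map_mul]; rfl

theorem geomRep_inv_apply_self (w : W) (v : S → ℝ) :
    cs.geomRep w⁻¹ (cs.geomRep w v) = v := by
  rw [← geomRep_mul_apply, inv_mul_cancel, map_one]; rfl

theorem geomRep_apply_inv_self (w : W) (v : S → ℝ) :
    cs.geomRep w (cs.geomRep w⁻¹ v) = v := by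
  rw [← geomRep_mul_apply, mul_inv_cancel, map_one]; rfl

theorem geomRep_simple_self (s : S) :
    cs.geomRep (cs.simple s) (M.simpleRoot s) = -M.simpleRoot s := by
  rw [geomRep_simple, CoxeterMatrix.simpleRefl, Module.reflection_apply_self]

theorem titsForm_geomRep (w : W) (x y : S → ℝ) :
    M.titsForm (cs.geomRep w x) (cs.geomRep w y) = M.titsForm x y := by
  induction w using cs.simple_induction generalizing x y with
  | simple s =>
    simp only [geomRep_simple, M.simpleRefl_apply, map_sub, map_smul, LinearMap.sub_apply,
      LinearMap.smul_apply, smul_eq_mul, M.titsForm_simpleRoot, M.titsMatrix_diag,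
      M.titsForm_comm x (M.simpleRoot s)]
    ring
  | one => simp
  | mul w w' hw hw' => rw [geomRep_mul_apply, geomRep_mul_apply, hw, hw']

theorem geomRep_apply_of_mem_ker (w : W) {v : S → ℝ} (hv : v ∈ LinearMap.ker M.titsForm) :
    cs.geomRep w v = v := by
  induction w using cs.simple_induction with
  | simple s =>
    rw [geomRep_simple, M.simpleRefl_apply, M.titsForm_comm, LinearMap.mem_ker.mp hv]
    simp
  | one => simp
  | mul w w' hw hw' => rw [geomRep_mul_apply, hw', hw]

/-- The sequence `u₀ = 0`, `u₁ = 1`, `u_{k+2} = 2 c u_{k+1} - u_k`. -/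
def _root_.chebyshevSeq (c : ℝ) : ℕ → ℝ
  | 0 => 0
  | 1 => 1
  | k + 2 => 2 * c * chebyshevSeq c (k + 1) - chebyshevSeq c k

theorem _root_.chebyshevSeq_one (k : ℕ) : chebyshevSeq 1 k = k := by
  induction k using Nat.twoStepInduction with
  | zero => simp [chebyshevSeq]
  | one => simp [chebyshevSeq]
  | more k h1 h2 => rw [chebyshevSeq, h1, h2]; push_cast; ring

theorem _root_.chebyshevSeq_cos (θ : ℝ) (k : ℕ) :
    chebyshevSeq (Real.cos θ) k * Real.sin θ = Real.sin (k * θ) := by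
  induction k using Nat.twoStepInduction with
  | zero => simp [chebyshevSeq]
  | one => simp [chebyshevSeq]
  | more k h1 h2 =>
    rw [chebyshevSeq, sub_mul, mul_assoc, h1, h2]
    have e1 : ((k + 2 : ℕ) : ℝ) * θ = (k + 1 : ℕ) * θ + θ := by push_cast; ring
    have e2 : (k : ℝ) * θ = (k + 1 : ℕ) * θ - θ := by push_cast; ring
    rw [e1, e2, Real.sin_add, Real.sin_sub]
    ring

-- The value is k when m = ∞ and sin (kπ/m) / sin (π/m) otherwise, where kπ/m stays in [0, π].
omit [Fintype S] [DecidableEq S] in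
theorem chebyshevSeq_nonneg {s t : S} (hst : s ≠ t) {k : ℕ} (hk : M s t = 0 ∨ k ≤ M s t) :
    0 ≤ chebyshevSeq (-M.titsMatrix s t) k := by
  by_cases h0 : M s t = 0
  · rw [CoxeterMatrix.titsMatrix, if_pos h0, neg_neg, chebyshevSeq_one]
    positivity
  · have hk := hk.resolve_left h0
    have h2 : (2 : ℝ) ≤ M s t := by exact_mod_cast M.two_le_of_ne hst h0
    have hk' : (k : ℝ) ≤ M s t := by exact_mod_cast hk
    rw [CoxeterMatrix.titsMatrix, if_neg h0, neg_neg]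
    have hpi := Real.pi_pos
    have hm : (M s t : ℝ) ≠ 0 := by positivity
    have hθ : 0 < Real.pi / (M s t : ℝ) := by positivity
    have hsin : 0 < Real.sin (Real.pi / (M s t : ℝ)) := by
      apply Real.sin_pos_of_pos_of_lt_pi hθ
      apply div_lt_self hpi; linarith
    refine nonneg_of_mul_nonneg_left (b := Real.sin (Real.pi / (M s t : ℝ))) ?_ hsin
    rw [chebyshevSeq_cos]
    apply Real.sin_nonneg_of_nonneg_of_le_pi (by positivity)
    calc (k : ℝ) * (Real.pi / M s t) ≤ M s t * (Real.pi / M s t) := by gcongr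
      _ = Real.pi := by field_simp

/-- This is the rank two computation behind the positivity of roots: together with
`chebyshevSeq_nonneg` it makes both coefficients nonnegative as long as k + 1 ≤ m. -/
theorem geomRep_alternatingWord (s t : S) (k : ℕ) :
    cs.geomRep (cs.wordProd (alternatingWord s t k)) (M.simpleRoot s) =
      if Even k then
        chebyshevSeq (-M.titsMatrix s t) (k + 1) • M.simpleRoot s +
          chebyshevSeq (-M.titsMatrix s t) k • M.simpleRoot t
      else
        chebyshevSeq (-M.titsMatrix s t) (k + 1) • M.simpleRoot t +
          chebyshevSeq (-M.titsMatrix s t) k • M.simpleRoot s := by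
  induction k with
  | zero => simp [alternatingWord, chebyshevSeq]
  | succ k ih =>
    rw [alternatingWord_succ', wordProd_cons, geomRep_mul_apply, ih]
    by_cases hk : Even k
    · have hk' : ¬ Even (k + 1) := by simpa [Nat.even_add_one] using hk
      simp only [hk, hk', if_true, if_false, geomRep_simple, M.simpleRefl_apply, map_add, map_smul,
        M.titsForm_simpleRoot, M.titsMatrix_diag, M.titsMatrix_symm t s, smul_eq_mul, chebyshevSeq]
      module
    · have hk' : Even (k + 1) := by simpa [Nat.even_add_one] using hk
      simp only [hk, hk', if_true, if_false, geomRep_simple, M.simpleRefl_apply, map_add, map_smul,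
        M.titsForm_simpleRoot, M.titsMatrix_diag, smul_eq_mul, chebyshevSeq]
      module

/-- If `ℓ(ws) > ℓ(w)` then the root `w e_s` is nonnegative. -/
theorem geomRep_simpleRoot_nonneg (w : W) (s : S) (h : ¬ cs.IsRightDescent w s) :
    0 ≤ cs.geomRep w (M.simpleRoot s) := by
  induction hn : cs.length w using Nat.strong_induction_on generalizing w s with
  | _ n ih =>
  by_cases hw : w = 1
  · subst hw
    simp [CoxeterMatrix.simpleRoot, Pi.single_nonneg]
  -- Write w = v a with lengths adding up, where a is the longest possible alternating word in s and
  -- t ending in t. Then a e_s is a nonnegative combination of e_s and e_t, and the induction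
  -- hypothesis applies to v with both letters.
  obtain ⟨t, ht⟩ := cs.exists_rightDescent_of_ne_one hw
  have hst : s ≠ t := by rintro rfl; exact h ht
  -- peel off the longest alternating suffix
  let P : ℕ → Prop := fun k => cs.length (w * (cs.wordProd (alternatingWord s t k))⁻¹) + k =
    cs.length w
  have hP1 : P 1 := by
    have := cs.isRightDescent_iff.mp ht
    simpa [P, alternatingWord] using this
  have hPb : ∀ k, P k → k ≤ cs.length w := fun k hk => by
    change _ + k = _ at hk
    omega
  classical
  set k := Nat.findGreatest P (cs.length w) with hk
  have hPk : P k := Nat.findGreatest_spec (hPb 1 hP1) hP1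
  have hk1 : 1 ≤ k := Nat.le_findGreatest (hPb 1 hP1) hP1
  have hPk1 : ¬ P (k + 1) := fun hp =>
    absurd (Nat.le_findGreatest (hPb _ hp) hp) (by omega)
  clear_value k
  set a := cs.wordProd (alternatingWord s t k) with ha
  set v := w * a⁻¹ with hv
  have hwv : w = v * a := by rw [hv, inv_mul_cancel_right]
  have hlv : cs.length v + k = cs.length w := hPk
  have hka : ∀ j, cs.length (cs.wordProd (alternatingWord s t j)) ≤ j := fun j => by
    simpa using cs.length_wordProd_le (alternatingWord s t j)
  -- Since ws is longer than w, the alternating word a s of length k + 1 is reduced, and alternating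
  -- words longer than m are not.
  have hkm : M s t = 0 ∨ k + 1 ≤ M s t := by
    by_contra! hc
    have hred : cs.IsReduced (alternatingWord t s (k + 1)) := by
      unfold IsReduced
      refine le_antisymm (cs.length_wordProd_le _) ?_
      rw [length_alternatingWord, alternatingWord_succ, wordProd_concat, ← ha]
      have h1 := cs.not_isRightDescent_iff.mp h
      have h2 := cs.length_mul_le v (a * cs.simple s)
      rw [← mul_assoc, ← hwv] at h2
      omega
    refine cs.not_isReduced_alternatingWord t s ?_ ?_ hred
    · rw [M.symmetric]; exact hc.1
    · rw [M.symmetric]; exact hc.2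
  -- the two letters
  have hnext : ¬ cs.IsRightDescent v (if Even k then t else s) := by
    intro hd
    apply hPk1
    change cs.length (w * _) + (k + 1) = _
    rw [alternatingWord_succ', wordProd_cons, mul_inv_rev, inv_simple, ← mul_assoc, ← ha, ← hv]
    have := cs.isRightDescent_iff.mp hd
    omega
  -- This letter is the first one of a; if v could be shortened by it, cancelling it on both sides
  -- would write w with fewer than ℓ(w) letters.
  have hprev : ¬ cs.IsRightDescent v (if Even k then s else t) := by
    intro hd
    have h3 := cs.isRightDescent_iff.mp hd
    obtain ⟨j, rfl⟩ : ∃ j, k = j + 1 := ⟨k - 1, by omega⟩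
    have h4 : w = (v * cs.simple (if Even (j + 1) then s else t)) *
        cs.wordProd (alternatingWord s t j) := by
      rw [hwv, ha, alternatingWord_succ', wordProd_cons]
      by_cases hj : Even j
      · have hj' : ¬ Even (j + 1) := by simpa [Nat.even_add_one] using hj
        simp [hj, hj', mul_assoc]
      · have hj' : Even (j + 1) := by simpa [Nat.even_add_one] using hj
        simp [hj, hj', mul_assoc]
    have h5 := cs.length_mul_le (v * cs.simple (if Even (j + 1) then s else t))
      (cs.wordProd (alternatingWord s t j))
    rw [← h4] at h5
    have := hka j
    omega
  have hvlt : cs.length v < n := by omega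
  have hvs : 0 ≤ cs.geomRep v (M.simpleRoot s) := by
    refine ih _ hvlt v s ?_ rfl
    by_cases hj : Even k
    · simpa [hj] using hprev
    · simpa [hj] using hnext
  have hvt : 0 ≤ cs.geomRep v (M.simpleRoot t) := by
    refine ih _ hvlt v t ?_ rfl
    by_cases hj : Even k
    · simpa [hj] using hnext
    · simpa [hj] using hprev
  have hu1 := chebyshevSeq_nonneg (M := M) hst (k := k + 1) hkm
  have hu0 := chebyshevSeq_nonneg (M := M) hst (k := k) (hkm.imp_right (by omega))
  rw [hwv, geomRep_mul_apply, ha, geomRep_alternatingWord]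
  split_ifs
  all_goals
    rw [map_add, map_smul, map_smul]
    exact add_nonneg (smul_nonneg hu1 ‹_›) (smul_nonneg hu0 ‹_›)

theorem geomRep_simpleRoot_nonpos (w : W) (s : S) (h : cs.IsRightDescent w s) :
    cs.geomRep w (M.simpleRoot s) ≤ 0 := by
  have h1 := cs.geomRep_simpleRoot_nonneg (w * cs.simple s) s
    (cs.isRightDescent_iff_not_isRightDescent_mul.mp h)
  rw [geomRep_mul_apply, geomRep_simple_self, map_neg] at h1
  exact neg_nonneg.mp h1

/-- An element that sends every simple root to a vector whose corresponding coordinate is positive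
is trivial. -/
theorem eq_one_of_forall_pos (w : W) (h : ∀ s, 0 < cs.geomRep w (M.simpleRoot s) s) : w = 1 := by
  by_contra hw
  obtain ⟨s, hs⟩ := cs.exists_rightDescent_of_ne_one hw
  exact absurd (cs.geomRep_simpleRoot_nonpos w s hs s) (not_le.mpr (h s))

theorem geomRep_injective : Function.Injective cs.geomRep := by
  rw [injective_iff_map_eq_one]
  intro w hw
  apply cs.eq_one_of_forall_pos
  intro s
  rw [hw]
  simp [CoxeterMatrix.simpleRoot]

end CoxeterSystem

open Topology in
/-- An infinite bounded set in a finite-dimensional space contains pairs of distinct points that are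
arbitrarily close to a common limit point. -/
theorem exists_forall_nhds_prod_of_infinite {E : Type*} [MetricSpace E] [ProperSpace E]
    {A : Set E} (hA : A.Infinite) (hb : Bornology.IsBounded A) :
    ∃ x ∈ closure A, ∀ U ∈ 𝓝 (x, x), ∃ y ∈ A, ∃ z ∈ A, y ≠ z ∧ (y, z) ∈ U := by
  obtain ⟨x, hx, hacc⟩ := hA.exists_accPt_of_subset_isCompact hb.isCompact_closure subset_closure
  refine ⟨x, hx, fun U hU => ?_⟩
  rw [nhds_prod_eq, Filter.mem_prod_self_iff] at hU
  obtain ⟨V, hV, hVU⟩ := hU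
  rw [accPt_iff_nhds] at hacc
  obtain ⟨y, ⟨hyV, hyA⟩, hyx⟩ := hacc V hV
  obtain ⟨z, ⟨hzV, hzA⟩, hzx⟩ := hacc (V ∩ {y}ᶜ)
    (Filter.inter_mem hV (isOpen_compl_singleton.mem_nhds (Ne.symm hyx)))
  exact ⟨y, hyA, z, hzA, fun h => hzV.2 h.symm, hVU ⟨hyV, hzV.1⟩⟩

/-! ### Boundedness of unit spheres of definite forms. -/

section PosDef

variable {E : Type*} [NormedAddCommGroup E] [NormedSpace ℝ E] [FiniteDimensional ℝ E]

theorem continuous_bilinForm (B : LinearMap.BilinForm ℝ E) :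
    Continuous fun p : E × E => B p.1 p.2 := by
  have h : Continuous fun p : E × E =>
      (LinearMap.toContinuousLinearMap.toLinearMap.comp B).toContinuousLinearMap p.1 p.2 := by
    fun_prop
  exact h

/-- The unit sphere of a bilinear form that is positive definite on a subspace is bounded. -/
theorem isBounded_unitSphere_of_posDef (B : LinearMap.BilinForm ℝ E) (P : Submodule ℝ E)
    (hP : ∀ v ∈ P, v ≠ 0 → 0 < B v v) : Bornology.IsBounded {v | v ∈ P ∧ B v v = 1} := by
  have hcont : Continuous fun v : E => B v v :=
    (continuous_bilinForm B).comp (continuous_id.prodMk continuous_id)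
  have hcomp : IsCompact (Metric.sphere (0 : E) 1 ∩ P) :=
    (isCompact_sphere 0 1).inter_right P.closed_of_finiteDimensional
  rcases (Metric.sphere (0 : E) 1 ∩ P).eq_empty_or_nonempty with hem | hne
  · refine Bornology.isBounded_empty.subset fun v ⟨hv, hv1⟩ => ?_
    have hv0 : v ≠ 0 := by rintro rfl; simp at hv1
    have : ‖v‖⁻¹ • v ∈ Metric.sphere (0 : E) 1 ∩ P :=
      ⟨by simp [norm_smul, hv0], P.smul_mem (‖v‖⁻¹) hv⟩
    rw [hem] at this
    exact this
  -- The minimum B(u,u) > 0 on the compact norm sphere of P gives B(v,v) ≥ B(u,u) ‖v‖² by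
  -- homogeneity.
  obtain ⟨u, ⟨hu1, huP⟩, hmin⟩ := hcomp.exists_isMinOn hne hcont.continuousOn
  have hu0 : u ≠ 0 := by rintro rfl; simp at hu1
  have hc := hP u huP hu0
  rw [isBounded_iff_forall_norm_le]
  refine ⟨Real.sqrt ((B u u)⁻¹), fun v ⟨hv, hv1⟩ => ?_⟩
  have hv0 : v ≠ 0 := by rintro rfl; simp at hv1
  have hn : 0 < ‖v‖ := norm_pos_iff.mpr hv0
  have h1 : B u u ≤ B (‖v‖⁻¹ • v) (‖v‖⁻¹ • v) :=
    hmin ⟨by simp [norm_smul, hv0], P.smul_mem (‖v‖⁻¹) hv⟩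
  rw [map_smul, map_smul, LinearMap.smul_apply, hv1, smul_eq_mul, smul_eq_mul, mul_one] at h1
  apply Real.le_sqrt_of_sq_le
  rw [← inv_inv (‖v‖ ^ 2)]
  apply inv_anti₀ hc
  calc B u u ≤ ‖v‖⁻¹ * ‖v‖⁻¹ := h1
    _ = (‖v‖ ^ 2)⁻¹ := by rw [← mul_inv, sq]

end PosDef

/-! ### Isotropic vectors of semidefinite Tits forms. -/

namespace CoxeterMatrix

variable {S : Type*} [Fintype S] [DecidableEq S] (M : CoxeterMatrix S)

theorem continuous_titsForm {X : Type*} [TopologicalSpace X] {g h : X → S → ℝ}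
    (hg : Continuous g) (hh : Continuous h) : Continuous fun x => M.titsForm (g x) (h x) := by
  simp only [titsForm_apply]
  fun_prop

/-- The off-diagonal entries are nonpositive, so making all products of coordinates nonnegative can
only lower the form. -/
theorem titsForm_abs_le (v : S → ℝ) : M.titsForm |v| |v| ≤ M.titsForm v v := by
  rw [titsForm_apply, titsForm_apply]
  refine Finset.sum_le_sum fun s _ => Finset.sum_le_sum fun t _ => ?_
  by_cases hst : s = t
  · subst hst
    rw [titsMatrix_diag]
    simp
  · have h1 := M.titsMatrix_nonpos hst
    have h2 : v s * v t ≤ |v| s * |v| t := by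
      rw [Pi.abs_apply, Pi.abs_apply, ← abs_mul]; exact le_abs_self _
    nlinarith

variable {M}

theorem mem_ker_of_titsForm_self_eq_zero (hpsd : ∀ v, 0 ≤ M.titsForm v v) {v : S → ℝ}
    (hv : M.titsForm v v = 0) : v ∈ LinearMap.ker M.titsForm := by
  rw [LinearMap.mem_ker]
  refine LinearMap.ext fun w => ?_
  change M.titsForm v w = 0
  have h : ∀ t : ℝ, 0 ≤ 2 * t * M.titsForm v w + t ^ 2 * M.titsForm w w := fun t => by
    have := hpsd (v + t • w)
    simp only [map_add, map_smul, LinearMap.add_apply, LinearMap.smul_apply, smul_eq_mul, hv,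
      M.titsForm_comm w v] at this
    linarith
  have hw := hpsd w
  -- This is nearly the minimizer of the quadratic polynomial in t; the added 1 keeps the
  -- denominator positive when w is isotropic.
  have := h (-(M.titsForm v w) / (M.titsForm w w + 1))
  have hpos : 0 < M.titsForm w w + 1 := by linarith
  by_contra hne
  have hsq : 0 < (M.titsForm v w) ^ 2 := by positivity
  have e : 2 * (-(M.titsForm v w) / (M.titsForm w w + 1)) * M.titsForm v w +
      (-(M.titsForm v w) / (M.titsForm w w + 1)) ^ 2 * M.titsForm w w =
      -((M.titsForm v w) ^ 2 * (M.titsForm w w + 2)) / (M.titsForm w w + 1) ^ 2 := by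
    field_simp
    ring
  rw [e] at this
  have : -((M.titsForm v w) ^ 2 * (M.titsForm w w + 2)) / (M.titsForm w w + 1) ^ 2 < 0 := by
    apply div_neg_of_neg_of_pos
    · nlinarith
    · positivity
  linarith

theorem abs_mem_ker (hpsd : ∀ v, 0 ≤ M.titsForm v v) {v : S → ℝ}
    (hv : M.titsForm v v = 0) : |v| ∈ LinearMap.ker M.titsForm :=
  mem_ker_of_titsForm_self_eq_zero hpsd
    (le_antisymm ((M.titsForm_abs_le v).trans hv.le) (hpsd _))

/-- For an irreducible positive semidefinite Tits form, the nonzero isotropic vectors have no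
vanishing coordinate. -/
theorem apply_ne_zero_of_titsForm_self_eq_zero (hirr : M.IsIrreducible)
    (hpsd : ∀ v, 0 ≤ M.titsForm v v) {v : S → ℝ} (hv : M.titsForm v v = 0) (h0 : v ≠ 0) (s : S) :
    v s ≠ 0 := by
  intro hs
  apply h0
  -- Since |v| lies in the kernel, its pairing with e_a is zero. If v a = 0 this pairing is a sum of
  -- nonpositive terms, so all of them vanish, and the coefficients at neighbours of a are nonzero.
  have hadj : ∀ a b, M.coxeterGraph.Adj a b → v a = 0 → v b = 0 := by
    intro a b hab ha
    have h1 : M.titsForm (M.simpleRoot a) |v| = 0 := by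
      rw [M.titsForm_comm, LinearMap.mem_ker.mp (abs_mem_ker hpsd hv), LinearMap.zero_apply]
    rw [titsForm_simpleRoot_left] at h1
    have hle : ∀ t ∈ Finset.univ, M.titsMatrix a t * |v| t ≤ 0 := by
      intro t _
      by_cases hat : a = t
      · subst hat; simp [ha]
      · exact mul_nonpos_of_nonpos_of_nonneg (M.titsMatrix_nonpos hat) (abs_nonneg _)
    have := (Finset.sum_eq_zero_iff_of_nonpos hle).mp h1 b (Finset.mem_univ b)
    rcases mul_eq_zero.mp this with h | h
    · exact absurd h (M.titsMatrix_neg hab).ne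
    · exact abs_eq_zero.mp h
  ext t
  obtain ⟨p⟩ := hirr.preconnected s t
  induction p with
  | nil => exact hs
  | cons h _ ih => exact ih (hadj _ _ h hs)

theorem titsForm_self_pos_of_apply_eq_zero (hirr : M.IsIrreducible)
    (hpsd : ∀ v, 0 ≤ M.titsForm v v) {v : S → ℝ} {s : S} (hs : v s = 0) (h0 : v ≠ 0) :
    0 < M.titsForm v v :=
  lt_of_le_of_ne (hpsd v)
    fun h => apply_ne_zero_of_titsForm_self_eq_zero hirr hpsd h.symm h0 s hs

theorem exists_pos_mem_ker (hirr : M.IsIrreducible) (hpsd : ∀ v, 0 ≤ M.titsForm v v) {u : S → ℝ}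
    (hu : u ∈ LinearMap.ker M.titsForm) (h0 : u ≠ 0) :
    ∃ δ ∈ LinearMap.ker M.titsForm, ∀ s, 0 < δ s := by
  have h : M.titsForm u u = 0 := by rw [LinearMap.mem_ker.mp hu, LinearMap.zero_apply]
  exact ⟨|u|, abs_mem_ker hpsd h, fun s =>
    abs_pos.mpr (apply_ne_zero_of_titsForm_self_eq_zero hirr hpsd h h0 s)⟩

end CoxeterMatrix

/-! ### Discreteness of the set of roots; definite forms give finite groups. -/

namespace CoxeterSystem

variable {S W : Type*} [Fintype S] [DecidableEq S] [Group W] {M : CoxeterMatrix S}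
  (cs : CoxeterSystem M W)

/-- The roots of a Coxeter system: the images of the simple roots. -/
def roots : Set (S → ℝ) := {α | ∃ w s, cs.geomRep w (M.simpleRoot s) = α}

theorem simpleRoot_mem_roots (s : S) : M.simpleRoot s ∈ cs.roots := ⟨1, s, by simp⟩

variable {cs}

theorem geomRep_mem_roots (w : W) {α : S → ℝ} (hα : α ∈ cs.roots) : cs.geomRep w α ∈ cs.roots := by
  obtain ⟨w', s, rfl⟩ := hα
  exact ⟨w * w', s, cs.geomRep_mul_apply _ _ _⟩

theorem titsForm_self_of_mem_roots {α : S → ℝ} (hα : α ∈ cs.roots) : M.titsForm α α = 1 := by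
  obtain ⟨w, s, rfl⟩ := hα
  rw [titsForm_geomRep, M.titsForm_simpleRoot, M.titsMatrix_diag]

theorem nonneg_or_nonpos_of_mem_roots {α : S → ℝ} (hα : α ∈ cs.roots) : 0 ≤ α ∨ α ≤ 0 := by
  obtain ⟨w, s, rfl⟩ := hα
  by_cases h : cs.IsRightDescent w s
  · exact Or.inr (cs.geomRep_simpleRoot_nonpos w s h)
  · exact Or.inl (cs.geomRep_simpleRoot_nonneg w s h)

theorem exists_geomRep_eq_reflection {α : S → ℝ} (hα : α ∈ cs.roots) :
    ∃ w : W, ∀ v, cs.geomRep w v = v - (2 * M.titsForm α v) • α := by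
  obtain ⟨w, s, rfl⟩ := hα
  refine ⟨w * cs.simple s * w⁻¹, fun v => ?_⟩
  rw [geomRep_mul_apply, geomRep_mul_apply, geomRep_simple, M.simpleRefl_apply, map_sub, map_smul,
    geomRep_apply_inv_self, ← cs.titsForm_geomRep w (M.simpleRoot s), geomRep_apply_inv_self]

/-- Bounded sets of roots are finite. -/
theorem finite_of_isBounded_of_subset_roots {A : Set (S → ℝ)} (hA : A ⊆ cs.roots)
    (hb : Bornology.IsBounded A) : A.Finite := by
  by_contra hinf
  obtain ⟨x, hx, hU⟩ := exists_forall_nhds_prod_of_infinite hinf hb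
  have hx1 : M.titsForm x x = 1 := by
    have hcl : IsClosed {v : S → ℝ | M.titsForm v v = 1} :=
      isClosed_eq (M.continuous_titsForm continuous_id continuous_id) continuous_const
    exact closure_minimal (fun α hα => titsForm_self_of_mem_roots (hA hα)) hcl hx
  -- `f s (y, z)` is the s-coordinate of the image of e_s under the reflection in z followed by the
  -- one in y. At (x, x) the reflections cancel, so the value there is 1 and it stays positive
  -- nearby.
  let f : S → (S → ℝ) × (S → ℝ) → ℝ := fun s p =>
    ((M.simpleRoot s - (2 * M.titsForm p.2 (M.simpleRoot s)) • p.2) -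
      (2 * M.titsForm p.1 (M.simpleRoot s - (2 * M.titsForm p.2 (M.simpleRoot s)) • p.2)) • p.1) s
  have hf : ∀ s, Continuous (f s) := by
    intro s
    have h1 : Continuous fun p : (S → ℝ) × (S → ℝ) =>
        M.simpleRoot s - (2 * M.titsForm p.2 (M.simpleRoot s)) • p.2 :=
      continuous_const.sub ((continuous_const.mul (M.continuous_titsForm continuous_snd continuous_const)).smul
        continuous_snd)
    exact (continuous_apply s).comp
      (h1.sub ((continuous_const.mul (M.continuous_titsForm continuous_fst h1)).smul continuous_fst))
  have hfx : ∀ s, f s (x, x) = 1 := by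
    intro s
    have : (M.simpleRoot s - (2 * M.titsForm x (M.simpleRoot s)) • x) -
        (2 * M.titsForm x (M.simpleRoot s - (2 * M.titsForm x (M.simpleRoot s)) • x)) • x =
        M.simpleRoot s := by
      rw [map_sub, map_smul, hx1, smul_eq_mul]
      module
    change (_ - _ : S → ℝ) s = 1
    rw [this]
    simp [CoxeterMatrix.simpleRoot]
  have hev : ∀ᶠ p in nhds (x, x), (∀ s, 0 < f s p) ∧ 0 < M.titsForm p.1 p.2 := by
    refine Filter.Eventually.and ?_ ?_
    · rw [Filter.eventually_all]
      intro s
      apply (hf s).continuousAt.eventually_const_lt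
      rw [hfx]
      exact one_pos
    · apply (M.continuous_titsForm continuous_fst continuous_snd).continuousAt.eventually_const_lt
      change 0 < M.titsForm x x
      rw [hx1]
      exact one_pos
  obtain ⟨y, hy, z, hz, hyz, hp, hpos⟩ := hU _ hev
  obtain ⟨a, ha⟩ := exists_geomRep_eq_reflection (hA hy)
  obtain ⟨b, hb⟩ := exists_geomRep_eq_reflection (hA hz)
  have hab : a * b = 1 := by
    apply cs.eq_one_of_forall_pos
    intro s
    rw [geomRep_mul_apply, ha, hb]
    exact hp s
  have hy1 := titsForm_self_of_mem_roots (hA hy)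
  have hz1 := titsForm_self_of_mem_roots (hA hz)
  -- The two reflections are inverse to each other, which makes z proportional to y; both have norm
  -- one and B(y,z) > 0, so they coincide.
  have h1 : cs.geomRep (a * b) z = z := by rw [hab]; simp
  rw [geomRep_mul_apply, ha, hb, hz1] at h1
  have h2 : z = M.titsForm y z • y := by
    have : (2 : ℝ) • z = (2 : ℝ) • (M.titsForm y z • y) := by
      rw [mul_one, map_sub, map_smul, smul_eq_mul] at h1
      linear_combination (norm := module) -h1
    exact smul_right_injective _ (two_ne_zero (α := ℝ)) this
  have h3 : M.titsForm y z ^ 2 = 1 := by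
    have := hz1
    rw [h2] at this
    simp only [map_smul, LinearMap.smul_apply, smul_eq_mul, hy1, mul_one] at this
    rw [sq]
    exact this
  have h4 : M.titsForm y z = 1 := by
    change 0 < M.titsForm y z at hpos
    nlinarith
  rw [h4, one_smul] at h2
  exact hyz h2.symm

variable (cs)

theorem geomRep_ext {w w' : W}
    (h : ∀ s, cs.geomRep w (M.simpleRoot s) = cs.geomRep w' (M.simpleRoot s)) : w = w' := by
  apply cs.geomRep_injective
  refine LinearEquiv.ext fun v => ?_
  rw [M.eq_sum_simpleRoot v]
  simp only [map_sum, map_smul, h]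

theorem finite_of_finite_roots (h : cs.roots.Finite) : Finite W := by
  have := h.to_subtype
  refine Finite.of_injective (β := S → cs.roots)
    (fun w s => ⟨cs.geomRep w (M.simpleRoot s), w, s, rfl⟩) fun w w' hww => ?_
  apply cs.geomRep_ext
  intro s
  exact congrArg Subtype.val (congrFun hww s)

/-- A Coxeter group with positive definite Tits form is finite. -/
theorem finite_of_posDef (cs : CoxeterSystem M W) (hpd : ∀ v, v ≠ 0 → 0 < M.titsForm v v) : Finite W := by
  apply cs.finite_of_finite_roots
  apply finite_of_isBounded_of_subset_roots subset_rfl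
  exact (isBounded_unitSphere_of_posDef M.titsForm ⊤ fun v _ => hpd v).subset
    fun α hα => ⟨trivial, titsForm_self_of_mem_roots hα⟩

end CoxeterSystem

/-! ### Semidefinite forms: the Tits cone and roots modulo the radical. -/

namespace CoxeterSystem

variable {S W : Type*} [Fintype S] [DecidableEq S] [Group W] {M : CoxeterMatrix S}
  {cs : CoxeterSystem M W}

/-- The projection along `δ` onto the hyperplane where the coordinate `s` vanishes. -/
def projAlong (δ : S → ℝ) (s : S) : (S → ℝ) →ₗ[ℝ] (S → ℝ) :=
  LinearMap.id - ((δ s)⁻¹ • LinearMap.proj s).smulRight δ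

omit [Fintype S] [DecidableEq S] in
theorem projAlong_apply (δ : S → ℝ) (s : S) (v : S → ℝ) :
    projAlong δ s v = v - ((δ s)⁻¹ * v s) • δ := rfl

omit [Fintype S] [DecidableEq S] in
theorem projAlong_apply_self {δ : S → ℝ} {s : S} (hδ : δ s ≠ 0) (v : S → ℝ) :
    projAlong δ s v s = 0 := by
  rw [projAlong_apply, Pi.sub_apply, Pi.smul_apply, smul_eq_mul]
  field_simp
  ring

theorem titsForm_projAlong {δ : S → ℝ} (hδ : δ ∈ LinearMap.ker M.titsForm) (s : S) (v w : S → ℝ) :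
    M.titsForm (projAlong δ s v) (projAlong δ s w) = M.titsForm v w := by
  have h1 : ∀ u, M.titsForm δ u = 0 := fun u => by
    rw [LinearMap.mem_ker.mp hδ, LinearMap.zero_apply]
  have h2 : ∀ u, M.titsForm u δ = 0 := fun u => by rw [M.titsForm_comm, h1]
  simp [projAlong_apply, h1, h2]

/-- Nonzero isotropic vectors have no zero coordinate, so the form is definite on each coordinate
hyperplane. -/
theorem isBounded_unitSphere_hyperplane (hirr : M.IsIrreducible) (hpsd : ∀ v, 0 ≤ M.titsForm v v)
    (s : S) : Bornology.IsBounded {v : S → ℝ | v s = 0 ∧ M.titsForm v v = 1} :=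
  isBounded_unitSphere_of_posDef M.titsForm (LinearMap.ker (LinearMap.proj s))
    fun _ hv h0 => CoxeterMatrix.titsForm_self_pos_of_apply_eq_zero hirr hpsd hv h0

/-- Only finitely many positive roots take negative values under a form that is positive on the
radical. -/
theorem finite_setOf_root_neg (hirr : M.IsIrreducible) (hpsd : ∀ v, 0 ≤ M.titsForm v v)
    {δ : S → ℝ} (hδ : δ ∈ LinearMap.ker M.titsForm) (hpos : ∀ s, 0 < δ s)
    (φ : Module.Dual ℝ (S → ℝ)) (hφ : φ δ = 1) :
    {α | α ∈ cs.roots ∧ 0 ≤ α ∧ φ α < 0}.Finite := by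
  apply finite_of_isBounded_of_subset_roots (fun α hα => hα.1)
  obtain ⟨s⟩ := hirr.nonempty
  obtain ⟨R, hR⟩ := isBounded_iff_forall_norm_le.mp (isBounded_unitSphere_hyperplane hirr hpsd s)
  set f := LinearMap.toContinuousLinearMap φ with hf
  rw [isBounded_iff_forall_norm_le]
  refine ⟨R + ‖f‖ * R * ‖δ‖, fun α ⟨hα, h0, hneg⟩ => ?_⟩
  set c := (δ s)⁻¹ * α s with hc
  set β := projAlong δ s α with hβ
  have hβR : ‖β‖ ≤ R := hR β ⟨projAlong_apply_self (hpos s).ne' α, by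
    rw [hβ, titsForm_projAlong hδ, titsForm_self_of_mem_roots hα]⟩
  have hα' : α = β + c • δ := by rw [hβ, projAlong_apply]; simp [c]
  have hc0 : 0 ≤ c := mul_nonneg (inv_nonneg.mpr (hpos s).le) (h0 s)
  have hfβ : |φ β| ≤ ‖f‖ * R := by
    have := f.le_opNorm β
    rw [Real.norm_eq_abs] at this
    exact this.trans (by gcongr)
  -- For α = β + c δ with β bounded, φ(α) = φ(β) + c < 0 bounds c from above; positivity of α bounds
  -- it from below.
  have hcle : c ≤ ‖f‖ * R := by
    rw [hα', map_add, map_smul, hφ, smul_eq_mul, mul_one] at hneg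
    have := neg_abs_le (φ β)
    linarith
  rw [hα']
  refine (norm_add_le _ _).trans (add_le_add hβR ?_)
  rw [norm_smul, Real.norm_of_nonneg hc0]
  gcongr

/-- The reflection changes only the coordinate s. If the image were nonpositive, the other
coordinates of α would vanish, and norm one would leave only α = e_s. -/
theorem geomRep_simple_nonneg {α : S → ℝ} (hα : α ∈ cs.roots) (h0 : 0 ≤ α) {s : S}
    (hne : α ≠ M.simpleRoot s) : 0 ≤ cs.geomRep (cs.simple s) α := by
  refine (nonneg_or_nonpos_of_mem_roots (geomRep_mem_roots (cs.simple s) hα)).resolve_right ?_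
  intro hle
  apply hne
  have hz : ∀ t, t ≠ s → α t = 0 := by
    intro t ht
    have := hle t
    rw [geomRep_simple, M.simpleRefl_apply] at this
    simp [CoxeterMatrix.simpleRoot, ht] at this
    exact le_antisymm this (h0 t)
  have hα' : α = α s • M.simpleRoot s := by
    ext t
    by_cases ht : t = s
    · simp [M.simpleRoot_apply, ht]
    · simp [M.simpleRoot_apply, ht, hz t ht]
  have h1 := titsForm_self_of_mem_roots hα
  rw [hα'] at h1
  simp only [map_smul, LinearMap.smul_apply, smul_eq_mul, M.titsForm_simpleRoot, M.titsMatrix_diag,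
    mul_one] at h1
  have h2 : α s = 1 := by
    have : 0 ≤ α s := h0 s
    nlinarith
  rw [hα', h2, one_smul]

/-- Every linear form that is positive on the radical lies in the Tits cone. -/
theorem exists_forall_nonneg (hirr : M.IsIrreducible) (hpsd : ∀ v, 0 ≤ M.titsForm v v)
    {δ : S → ℝ} (hδ : δ ∈ LinearMap.ker M.titsForm) (hpos : ∀ s, 0 < δ s)
    (φ : Module.Dual ℝ (S → ℝ)) (hφ : φ δ = 1) :
    ∃ w : W, ∀ s, 0 ≤ φ (cs.geomRep w (M.simpleRoot s)) := by
  induction hn : {α | α ∈ cs.roots ∧ 0 ≤ α ∧ φ α < 0}.ncard using Nat.strong_induction_on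
    generalizing φ with
  | _ n ih =>
  by_cases h : ∀ s, 0 ≤ φ (M.simpleRoot s)
  · exact ⟨1, by simpa using h⟩
  push Not at h
  obtain ⟨s, hs⟩ := h
  set φ' : Module.Dual ℝ (S → ℝ) := φ ∘ₗ (cs.geomRep (cs.simple s)).toLinearMap with hφ'
  have hφ'a : ∀ v, φ' v = φ (cs.geomRep (cs.simple s) v) := fun v => rfl
  have hφ'δ : φ' δ = 1 := by rw [hφ'a, geomRep_apply_of_mem_ker cs _ hδ, hφ]
  have hfin := finite_setOf_root_neg (cs := cs) hirr hpsd hδ hpos φ hφ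
  have hsmem : M.simpleRoot s ∈ {α | α ∈ cs.roots ∧ 0 ≤ α ∧ φ α < 0} :=
    ⟨cs.simpleRoot_mem_roots s, by simp [CoxeterMatrix.simpleRoot, Pi.single_nonneg], hs⟩
  -- The reflection in e_s maps the positive roots that are negative for φ' injectively to those
  -- that are negative for φ, and misses e_s itself.
  have hlt : {α | α ∈ cs.roots ∧ 0 ≤ α ∧ φ' α < 0}.ncard < n := by
    rw [← hn]
    refine lt_of_le_of_lt ?_ (Set.ncard_sdiff_singleton_lt_of_mem hsmem hfin)
    refine Set.ncard_le_ncard_of_injOn (cs.geomRep (cs.simple s)) ?_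
      (cs.geomRep (cs.simple s)).injective.injOn hfin.sdiff
    rintro α ⟨hα, h0, hneg⟩
    have hne : α ≠ M.simpleRoot s := by
      rintro rfl
      rw [hφ'a, geomRep_simple_self, map_neg] at hneg
      linarith
    refine ⟨⟨geomRep_mem_roots _ hα, geomRep_simple_nonneg hα h0 hne, hneg⟩, ?_⟩
    intro heq
    rw [Set.mem_singleton_iff] at heq
    have h1 : α = -M.simpleRoot s := by
      rw [← cs.geomRep_inv_apply_self (cs.simple s) α, heq, inv_simple, geomRep_simple_self]
    have h2 := h0 s
    rw [h1] at h2
    simp [CoxeterMatrix.simpleRoot] at h2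
    linarith
  obtain ⟨w, hw⟩ := ih _ hlt φ' hφ'δ rfl
  exact ⟨cs.simple s * w, fun t => by rw [geomRep_mul_apply]; exact hw t⟩

theorem finite_roots_hyperplane (hirr : M.IsIrreducible) (hpsd : ∀ v, 0 ≤ M.titsForm v v) :
    {α | α ∈ cs.roots ∧ ∃ s, α s = 0}.Finite := by
  have : {α | α ∈ cs.roots ∧ ∃ s, α s = 0} = ⋃ s, {α | α ∈ cs.roots ∧ α s = 0} := by
    ext; simp
  rw [this]
  refine Set.finite_iUnion fun s => finite_of_isBounded_of_subset_roots (fun α hα => hα.1) ?_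
  exact (isBounded_unitSphere_hyperplane hirr hpsd s).subset
    fun α hα => ⟨hα.2, titsForm_self_of_mem_roots hα.1⟩

/-- The Gram determinant 1 - B(α,β)² is nonzero, so the span of α and β meets the radical only in
zero and δ can be separated from it. -/
theorem exists_dual_eq_zero {δ α β : S → ℝ}
    (hδ : δ ∈ LinearMap.ker M.titsForm) (h0 : δ ≠ 0) (hα : M.titsForm α α = 1)
    (hβ : M.titsForm β β = 1) (hαβ : M.titsForm α β ^ 2 ≠ 1) :
    ∃ φ : Module.Dual ℝ (S → ℝ), φ δ = 1 ∧ φ α = 0 ∧ φ β = 0 := by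
  have hnot : δ ∉ Submodule.span ℝ {α, β} := by
    intro hmem
    obtain ⟨a, b, hab⟩ := Submodule.mem_span_pair.mp hmem
    have h1 : ∀ u, M.titsForm δ u = 0 := fun u => by
      rw [LinearMap.mem_ker.mp hδ, LinearMap.zero_apply]
    have e1 := h1 α
    have e2 := h1 β
    rw [← hab] at e1 e2
    simp only [map_add, map_smul, LinearMap.add_apply, LinearMap.smul_apply, smul_eq_mul, hα, hβ,
      M.titsForm_comm β α] at e1 e2
    have hb : b * (1 - M.titsForm α β ^ 2) = 0 := by linear_combination e2 - M.titsForm α β * e1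
    have hb0 : b = 0 := (mul_eq_zero.mp hb).resolve_right (by
      intro h; apply hαβ; linarith)
    have ha0 : a = 0 := by rw [hb0] at e1; linarith
    apply h0
    rw [← hab, ha0, hb0]
    simp
  obtain ⟨f, hf, hspan⟩ := Submodule.exists_dual_map_eq_bot_of_notMem hnot inferInstance
  have hz : ∀ v ∈ Submodule.span ℝ {α, β}, f v = 0 := fun v hv => by
    have : f v ∈ (Submodule.span ℝ {α, β}).map f := Submodule.mem_map_of_mem hv
    rwa [hspan, Submodule.mem_bot] at this
  refine ⟨(f δ)⁻¹ • f, ?_, ?_, ?_⟩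
  · simp [hf]
  · simp [hz α (Submodule.subset_span (by simp))]
  · simp [hz β (Submodule.subset_span (by simp))]

/-- Positive semidefinite case: the values of the Tits form on pairs of roots that are independent
modulo the radical form a finite set. -/
theorem finite_setOf_titsForm_roots (hirr : M.IsIrreducible) (hpsd : ∀ v, 0 ≤ M.titsForm v v)
    {δ : S → ℝ} (hδ : δ ∈ LinearMap.ker M.titsForm) (hpos : ∀ s, 0 < δ s) :
    {x | ∃ α ∈ cs.roots, ∃ β ∈ cs.roots, M.titsForm α β = x ∧ x ^ 2 ≠ 1}.Finite := by
  have hF := finite_roots_hyperplane (cs := cs) hirr hpsd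
  refine ((hF.prod hF).image fun p : (S → ℝ) × (S → ℝ) => M.titsForm p.1 p.2).subset ?_
  rintro x ⟨α, hα, β, hβ, rfl, hx⟩
  have hδ0 : δ ≠ 0 := by
    obtain ⟨s⟩ := hirr.nonempty
    rintro rfl
    exact lt_irrefl _ (hpos s)
  obtain ⟨φ, hφ, hφα, hφβ⟩ := exists_dual_eq_zero hδ hδ0 (titsForm_self_of_mem_roots hα)
    (titsForm_self_of_mem_roots hβ) hx
  -- Moving φ to the dominant chamber makes it nonnegative on simple roots. It is positive on some
  -- e_s because φ(δ) = 1, so roots killed by it have zero s-coordinate and belong to the finite set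
  -- `hF`.
  obtain ⟨w, hw⟩ := exists_forall_nonneg (cs := cs) hirr hpsd hδ hpos φ hφ
  have hval : ∀ v, φ (cs.geomRep w v) = ∑ s, v s * φ (cs.geomRep w (M.simpleRoot s)) := by
    intro v
    conv_lhs => rw [M.eq_sum_simpleRoot v]
    simp only [map_sum, map_smul, smul_eq_mul]
  obtain ⟨s, hs⟩ : ∃ s, 0 < φ (cs.geomRep w (M.simpleRoot s)) := by
    by_contra! hall
    have h1 := hval δ
    rw [geomRep_apply_of_mem_ker cs _ hδ, hφ] at h1
    have : ∑ s, δ s * φ (cs.geomRep w (M.simpleRoot s)) ≤ 0 :=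
      Finset.sum_nonpos fun s _ => mul_nonpos_of_nonneg_of_nonpos (hpos s).le (hall s)
    linarith
  have hzero : ∀ γ ∈ cs.roots, φ γ = 0 → (cs.geomRep w⁻¹ γ) s = 0 := by
    intro γ hγ hγ0
    have h1 := hval (cs.geomRep w⁻¹ γ)
    rw [geomRep_apply_inv_self, hγ0] at h1
    have : (cs.geomRep w⁻¹ γ) s * φ (cs.geomRep w (M.simpleRoot s)) = 0 := by
      rcases nonneg_or_nonpos_of_mem_roots (geomRep_mem_roots w⁻¹ hγ) with h | h
      · exact (Finset.sum_eq_zero_iff_of_nonneg fun t _ => mul_nonneg (h t) (hw t)).mp h1.symm s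
          (Finset.mem_univ s)
      · exact (Finset.sum_eq_zero_iff_of_nonpos
          fun t _ => mul_nonpos_of_nonpos_of_nonneg (h t) (hw t)).mp h1.symm s (Finset.mem_univ s)
    exact (mul_eq_zero.mp this).resolve_right hs.ne'
  refine ⟨(cs.geomRep w⁻¹ α, cs.geomRep w⁻¹ β), ⟨⟨geomRep_mem_roots _ hα, s, hzero α hα hφα⟩,
    ⟨geomRep_mem_roots _ hβ, s, hzero β hβ hφβ⟩⟩, ?_⟩
  exact cs.titsForm_geomRep _ _ _

/-- Positive semidefinite case: the set of roots modulo the radical is finite. -/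
theorem finite_projAlong_roots (hirr : M.IsIrreducible) (hpsd : ∀ v, 0 ≤ M.titsForm v v)
    {δ : S → ℝ} (hδ : δ ∈ LinearMap.ker M.titsForm) (hpos : ∀ s, 0 < δ s) (s : S) :
    (projAlong δ s '' cs.roots).Finite := by
  have hmem : ∀ x ∈ projAlong δ s '' cs.roots, x s = 0 ∧ M.titsForm x x = 1 := by
    rintro _ ⟨α, hα, rfl⟩
    exact ⟨projAlong_apply_self (hpos s).ne' α, by
      rw [titsForm_projAlong hδ, titsForm_self_of_mem_roots hα]⟩
  by_contra hinf
  obtain ⟨x, hx, hU⟩ := exists_forall_nhds_prod_of_infinite hinf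
    ((isBounded_unitSphere_hyperplane hirr hpsd s).subset hmem)
  have hcont : Continuous fun p : (S → ℝ) × (S → ℝ) => M.titsForm p.1 p.2 :=
    M.continuous_titsForm continuous_fst continuous_snd
  have hx1 : M.titsForm x x = 1 := by
    have hcl : IsClosed {v : S → ℝ | M.titsForm v v = 1} :=
      isClosed_eq (M.continuous_titsForm continuous_id continuous_id) continuous_const
    exact closure_minimal (fun α hα => (hmem α hα).2) hcl hx
  have hD := finite_setOf_titsForm_roots (cs := cs) hirr hpsd hδ hpos
  -- The finite set of values excludes 1, the value at (x, x). Thus two nearby projected roots pair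
  -- to exactly 1, their difference is isotropic, and it lies in a hyperplane where the form is
  -- definite.
  have hev : ∀ᶠ p in nhds (x, x), 0 < M.titsForm p.1 p.2 ∧ M.titsForm p.1 p.2 ∉
      {x | ∃ α ∈ cs.roots, ∃ β ∈ cs.roots, M.titsForm α β = x ∧ x ^ 2 ≠ 1} := by
    refine Filter.Eventually.and ?_ ?_
    · apply hcont.continuousAt.eventually_const_lt
      change 0 < M.titsForm x x
      rw [hx1]
      exact one_pos
    · refine hcont.continuousAt.eventually (hD.isClosed.isOpen_compl.mem_nhds ?_)
      change M.titsForm x x ∉ _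
      rw [hx1]
      rintro ⟨_, _, _, _, _, h⟩
      exact h (one_pow 2)
  obtain ⟨y, hy, z, hz, hyz, hp0, hp⟩ := hU _ hev
  change 0 < M.titsForm y z at hp0
  have h1 : M.titsForm y z = 1 := by
    by_contra hne
    apply hp
    obtain ⟨α, hα, rfl⟩ := hy
    obtain ⟨β, hβ, rfl⟩ := hz
    refine ⟨α, hα, β, hβ, ?_, ?_⟩
    · exact (titsForm_projAlong hδ s α β).symm
    · intro h
      rcases mul_eq_zero.mp (show (M.titsForm (projAlong δ s α) (projAlong δ s β) - 1) *
          (M.titsForm (projAlong δ s α) (projAlong δ s β) + 1) = 0 by linear_combination h) with h | h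
      · exact hne (sub_eq_zero.mp h)
      · linarith
  have h2 : (y - z) s = 0 := by
    rw [Pi.sub_apply, (hmem y hy).1, (hmem z hz).1, sub_zero]
  have h3 := CoxeterMatrix.titsForm_self_pos_of_apply_eq_zero hirr hpsd h2 (sub_ne_zero.mpr hyz)
  simp only [map_sub, LinearMap.sub_apply, (hmem y hy).2, (hmem z hz).2, h1,
    M.titsForm_comm z y] at h3
  linarith

end CoxeterSystem

/-- A finitely generated group that embeds into the additive group of a real vector space is free
abelian of finite rank. -/
theorem exists_mulEquiv_multiplicative_of_injective {T V : Type*} [Group T] [Group.FG T]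
    [AddCommGroup V] [Module ℝ V] (f : T →* Multiplicative V) (hf : Function.Injective f) :
    ∃ d : ℕ, Nonempty (T ≃* Multiplicative (Fin d → ℤ)) := by
  let g : Additive T →+ V := MonoidHom.toAdditiveLeft f
  have hg : Function.Injective g := hf
  let H : AddSubgroup V := g.range
  let e : Additive T ≃+ H := AddMonoidHom.ofInjective hg
  have hfg : AddGroup.FG H := by
    have : AddGroup.FG (Additive T) := inferInstance
    exact AddGroup.fg_of_surjective (f := e.toAddMonoidHom) e.surjective
  have : Module.Finite ℤ H := Module.Finite.iff_addGroup_fg.mpr hfg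
  have : IsAddTorsionFree V :=
    letI : Module ℚ V := Module.compHom V (algebraMap ℚ ℝ)
    IsAddTorsionFree.of_module_rat V
  let b := Module.finBasis ℤ H
  let e' : H ≃+ (Fin (Module.finrank ℤ H) → ℤ) := b.equivFun.toAddEquiv
  exact ⟨_, ⟨AddEquiv.toMultiplicativeRight (e.trans e')⟩⟩

/-! ### The translation subgroup; semidefinite forms give finite or affine groups. -/

namespace CoxeterSystem

variable {S W : Type*} [Fintype S] [DecidableEq S] [Group W] {M : CoxeterMatrix S}
  (cs : CoxeterSystem M W)

omit [DecidableEq S] in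
theorem group_fg (cs : CoxeterSystem M W) : Group.FG W := by
  classical
  exact ⟨⟨Finset.univ.image cs.simple, by simpa using cs.subgroup_closure_range_simple⟩⟩

/-- The subgroup of elements that act trivially modulo the radical of the Tits form. -/
def translationSubgroup : Subgroup W where
  carrier := {w | ∀ v, cs.geomRep w v - v ∈ LinearMap.ker M.titsForm}
  one_mem' v := by simp
  mul_mem' {w w'} hw hw' v := by
    have : cs.geomRep (w * w') v - v = (cs.geomRep w' v - v) + (cs.geomRep w v - v) := by
      rw [geomRep_mul_apply, ← sub_add_cancel (cs.geomRep w' v) v, map_add,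
        cs.geomRep_apply_of_mem_ker w (hw' v)]
      abel
    rw [this]
    exact add_mem (hw' v) (hw v)
  inv_mem' {w} hw v := by
    have := hw (cs.geomRep w⁻¹ v)
    rw [geomRep_apply_inv_self] at this
    rw [← neg_sub]
    exact neg_mem this

theorem inv_mul_mem_translationSubgroup_iff {w w' : W} : w⁻¹ * w' ∈ cs.translationSubgroup ↔
    ∀ s, cs.geomRep w' (M.simpleRoot s) - cs.geomRep w (M.simpleRoot s) ∈
      LinearMap.ker M.titsForm := by
  constructor
  · intro h s
    have h1 := h (M.simpleRoot s)
    rw [geomRep_mul_apply] at h1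
    have h2 := cs.geomRep_apply_of_mem_ker w h1
    rw [map_sub, geomRep_apply_inv_self] at h2
    rw [h2]
    exact h1
  · intro h v
    have hv : cs.geomRep w' v - cs.geomRep w v ∈ LinearMap.ker M.titsForm := by
      rw [M.eq_sum_simpleRoot v]
      simp only [map_sum, map_smul, ← Finset.sum_sub_distrib, ← smul_sub]
      exact sum_mem fun s _ => Submodule.smul_mem _ _ (h s)
    have h2 := cs.geomRep_apply_of_mem_ker w⁻¹ hv
    rw [map_sub, geomRep_inv_apply_self, ← geomRep_mul_apply] at h2
    rw [h2]
    exact hv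

variable {cs}

/-- Modulo the radical, the kernel is spanned by any of its vectors without zero coordinates. -/
theorem mem_ker_iff_projAlong (hirr : M.IsIrreducible) (hpsd : ∀ v, 0 ≤ M.titsForm v v)
    {δ : S → ℝ} (hδ : δ ∈ LinearMap.ker M.titsForm) {s : S} (hs : δ s ≠ 0) {v : S → ℝ} :
    v ∈ LinearMap.ker M.titsForm ↔ projAlong δ s v = 0 := by
  constructor
  · intro hv
    by_contra h
    have h1 := CoxeterMatrix.titsForm_self_pos_of_apply_eq_zero hirr hpsd
      (projAlong_apply_self hs v) h
    rw [titsForm_projAlong hδ, LinearMap.mem_ker.mp hv] at h1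
    simp at h1
  · intro h
    rw [projAlong_apply, sub_eq_zero] at h
    rw [h]
    exact Submodule.smul_mem _ _ hδ

/-- A coset is determined by the images of the simple roots modulo δ, and each of these ranges over
a finite set. -/
theorem finiteIndex_translationSubgroup (hirr : M.IsIrreducible)
    (hpsd : ∀ v, 0 ≤ M.titsForm v v) {δ : S → ℝ} (hδ : δ ∈ LinearMap.ker M.titsForm)
    (hpos : ∀ s, 0 < δ s) : cs.translationSubgroup.FiniteIndex := by
  obtain ⟨s⟩ := hirr.nonempty
  have hfin := (finite_projAlong_roots (cs := cs) hirr hpsd hδ hpos s).to_subtype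
  have hiff : ∀ w w' : W, w⁻¹ * w' ∈ cs.translationSubgroup ↔ ∀ t,
      projAlong δ s (cs.geomRep w (M.simpleRoot t)) =
        projAlong δ s (cs.geomRep w' (M.simpleRoot t)) := by
    intro w w'
    rw [inv_mul_mem_translationSubgroup_iff]
    refine forall_congr' fun t => ?_
    rw [mem_ker_iff_projAlong hirr hpsd hδ (hpos s).ne', map_sub, sub_eq_zero, eq_comm]
  let f : W → S → projAlong δ s '' cs.roots :=
    fun w t => ⟨projAlong δ s (cs.geomRep w (M.simpleRoot t)), _, ⟨w, t, rfl⟩, rfl⟩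
  have hf : ∀ w w' : W, f w = f w' ↔ w⁻¹ * w' ∈ cs.translationSubgroup := by
    intro w w'
    rw [hiff, funext_iff]
    exact forall_congr' fun t => Subtype.ext_iff
  have : Finite (W ⧸ cs.translationSubgroup) := by
    refine Finite.of_injective (Quotient.lift f fun w w' h => (hf w w').mpr
      (QuotientGroup.leftRel_apply.mp h)) ?_
    rintro ⟨w⟩ ⟨w'⟩ h
    exact QuotientGroup.eq.mpr ((hf w w').mp h)
  exact Subgroup.finiteIndex_of_finite_quotient

/-- The translation vector of an element of the translation subgroup. -/
def translationHom (cs : CoxeterSystem M W) (s : S) :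
    cs.translationSubgroup →* Multiplicative (S → ℝ) where
  toFun w := Multiplicative.ofAdd
    fun t => (cs.geomRep w.1 (M.simpleRoot t) - M.simpleRoot t) s
  map_one' := by
    rw [← ofAdd_zero]
    congr 1
    funext t
    simp
  map_mul' w w' := by
    rw [← ofAdd_add]
    congr 1
    funext t
    have h1 := cs.geomRep_apply_of_mem_ker w.1 (w'.2 (M.simpleRoot t))
    rw [map_sub] at h1
    change (cs.geomRep (w.1 * w'.1) _ - _) s = _ + _
    rw [geomRep_mul_apply, ← Pi.add_apply, sub_eq_iff_eq_add.mp h1]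
    refine congrFun (?_ : _ = _) s
    abel

/-- A single coordinate suffices: by hypothesis a radical vector is determined by its s-coordinate.
-/
theorem translationHom_injective {δ : S → ℝ} {s : S}
    (hδ : ∀ v ∈ LinearMap.ker M.titsForm, projAlong δ s v = 0) :
    Function.Injective (cs.translationHom s) := by
  rw [injective_iff_map_eq_one]
  rintro ⟨w, hw⟩ h
  rw [Subgroup.mk_eq_one]
  apply cs.geomRep_ext
  intro t
  have h1 := hδ _ (hw (M.simpleRoot t))
  have h2 : (cs.geomRep w (M.simpleRoot t) - M.simpleRoot t) s = 0 := congrFun h t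
  rw [projAlong_apply, h2, mul_zero, zero_smul, sub_zero, sub_eq_zero] at h1
  simpa using h1

/-- An irreducible Coxeter group with positive semidefinite Tits form is finite or affine. -/
theorem finite_or_isAffineGroup (cs : CoxeterSystem M W) (hirr : M.IsIrreducible) (hpsd : ∀ v, 0 ≤ M.titsForm v v) :
    Finite W ∨ IsAffineGroup W := by
  by_cases hker : LinearMap.ker M.titsForm = ⊥
  · left
    apply cs.finite_of_posDef
    intro v hv
    refine lt_of_le_of_ne (hpsd v) fun h => hv ?_
    have := CoxeterMatrix.mem_ker_of_titsForm_self_eq_zero hpsd h.symm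
    rwa [hker, Submodule.mem_bot] at this
  rw [or_iff_not_imp_left]
  intro hinf
  obtain ⟨u, hu, hu0⟩ := Submodule.exists_mem_ne_zero_of_ne_bot hker
  obtain ⟨δ, hδ, hpos⟩ := CoxeterMatrix.exists_pos_mem_ker hirr hpsd hu hu0
  obtain ⟨s⟩ := hirr.nonempty
  have hidx := finiteIndex_translationSubgroup (cs := cs) hirr hpsd hδ hpos
  have := cs.group_fg
  have hfg : Group.FG cs.translationSubgroup := inferInstance
  obtain ⟨d, ⟨e⟩⟩ := exists_mulEquiv_multiplicative_of_injective _
    (translationHom_injective (cs := cs) (δ := δ) (s := s) fun v hv => (mem_ker_iff_projAlong hirr hpsd hδ (hpos s).ne').mp hv)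
  refine ⟨not_finite_iff_infinite.mp hinf, d, ?_, cs.translationSubgroup, hidx, ⟨e⟩⟩
  by_contra hd
  obtain rfl : d = 0 := by omega
  apply hinf
  have : Finite (Multiplicative (Fin 0 → ℤ)) := inferInstanceAs (Finite (Fin 0 → ℤ))
  have hT : Finite cs.translationSubgroup := Finite.of_equiv _ e.symm.toEquiv
  exact (Subgroup.finite_iff_finite_and_finiteIndex cs.translationSubgroup).mpr ⟨hT, hidx⟩

end CoxeterSystem

/-! ### Connected Gram matrices of size at most four. -/

section SmallGram

open Matrix

variable {n : Type*} [Fintype n] [DecidableEq n] {G : Matrix n n ℝ}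

omit [DecidableEq n] in
theorem dotProduct_mulVec_eq_sum (G : Matrix n n ℝ) (a b : n → ℝ) :
    a ⬝ᵥ G *ᵥ b = ∑ i, ∑ j, a i * G i j * b j := by
  simp only [dotProduct, mulVec, Finset.mul_sum, mul_assoc]

/-- A lower bound for the Gram form on nonnegative vectors in terms of the size of the support. -/
theorem two_sub_card_mul_le (hdiag : ∀ i, G i i = 1) (hge : ∀ i j, -1 ≤ G i j) {a : n → ℝ}
    (ha : 0 ≤ a) :
    (2 - ((Finset.univ.filter fun i => a i ≠ 0).card : ℝ)) * ∑ i, a i ^ 2 ≤ a ⬝ᵥ G *ᵥ a := by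
  -- Entrywise, G dominates twice the identity minus the all-ones matrix. Cauchy-Schwarz on the
  -- support then bounds the square of the sum.
  have h1 : 2 * ∑ i, a i ^ 2 - (∑ i, a i) ^ 2 ≤ a ⬝ᵥ G *ᵥ a := by
    have e : 2 * ∑ i, a i ^ 2 - (∑ i, a i) ^ 2 =
        ∑ i, ∑ j, ((if i = j then 2 * a i ^ 2 else 0) - a i * a j) := by
      rw [sq (∑ i, a i), Finset.sum_mul_sum, Finset.mul_sum]
      simp only [Finset.sum_sub_distrib, Finset.sum_ite_eq, Finset.mem_univ, if_true]
    rw [dotProduct_mulVec_eq_sum, e]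
    refine Finset.sum_le_sum fun i _ => Finset.sum_le_sum fun j _ => ?_
    split_ifs with h
    · subst h
      rw [hdiag]
      linarith [sq (a i)]
    · have := mul_nonneg (ha i) (ha j)
      nlinarith [hge i j]
  have h2 : (∑ i, a i) ^ 2 ≤ ((Finset.univ.filter fun i => a i ≠ 0).card : ℝ) * ∑ i, a i ^ 2 := by
    have e1 : ∑ i, a i = ∑ i ∈ Finset.univ.filter fun i => a i ≠ 0, a i :=
      (Finset.sum_filter_ne_zero _).symm
    rw [e1]
    refine sq_sum_le_card_mul_sum_sq.trans ?_
    gcongr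
    exact Finset.filter_subset _ _
  linarith

/-- Two nonnegative vectors with disjoint supports cannot both be isotropic or negative for an
irreducible Gram form of size at most four. -/
theorem false_of_disjoint_nonpos (hcard : Fintype.card n ≤ 4) (hdiag : ∀ i, G i i = 1)
    (hge : ∀ i j, -1 ≤ G i j) (hle : ∀ i j, i ≠ j → G i j ≤ 0)
    (hconn : ∀ A : Set n, A.Nonempty → Aᶜ.Nonempty → ∃ i ∈ A, ∃ j ∉ A, G i j ≠ 0)
    {a b : n → ℝ} (ha : 0 ≤ a) (hb : 0 ≤ b) (ha0 : a ≠ 0) (hb0 : b ≠ 0)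
    (hdisj : ∀ i, a i = 0 ∨ b i = 0) (haa : a ⬝ᵥ G *ᵥ a ≤ a ⬝ᵥ G *ᵥ b)
    (hbb : b ⬝ᵥ G *ᵥ b ≤ a ⬝ᵥ G *ᵥ b) : False := by
  set A := Finset.univ.filter fun i => a i ≠ 0 with hA
  set C := Finset.univ.filter fun i => b i ≠ 0 with hC
  have hAC : Disjoint A C := by
    rw [Finset.disjoint_left]
    intro i hi hj
    simp only [hA, hC, Finset.mem_filter, Finset.mem_univ, true_and] at hi hj
    exact (hdisj i).elim hi hj
  have hcardAC : A.card + C.card ≤ 4 := by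
    rw [← Finset.card_union_of_disjoint hAC]
    exact (Finset.card_le_univ _).trans hcard
  have hterm : ∀ i j, a i * G i j * b j ≤ 0 := by
    intro i j
    by_cases hij : i = j
    · subst hij
      rcases hdisj i with h | h <;> simp [h]
    · have := mul_nonneg (ha i) (hb j)
      nlinarith [hle i j hij]
  have hab : a ⬝ᵥ G *ᵥ b ≤ 0 := by
    rw [dotProduct_mulVec_eq_sum]
    exact Finset.sum_nonpos fun i _ => Finset.sum_nonpos fun j _ => hterm i j
  have hpos : ∀ c : n → ℝ, c ≠ 0 → 0 < ∑ i, c i ^ 2 := by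
    intro c hc
    obtain ⟨i, hi⟩ := Function.ne_iff.mp hc
    exact Finset.sum_pos' (fun _ _ => sq_nonneg _) ⟨i, Finset.mem_univ i, by
      have : c i ≠ 0 := hi
      positivity⟩
  have hA2 := two_sub_card_mul_le hdiag hge ha
  have hC2 := two_sub_card_mul_le hdiag hge hb
  -- A support with at most one index would make the form positive on a, whereas the cross term is
  -- nonpositive.
  have hAcard : 2 ≤ A.card := by
    by_contra! h
    have : (A.card : ℝ) ≤ 1 := by exact_mod_cast Nat.lt_succ_iff.mp h
    nlinarith [hpos a ha0]
  have hCcard : 2 ≤ C.card := by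
    by_contra! h
    have : (C.card : ℝ) ≤ 1 := by exact_mod_cast Nat.lt_succ_iff.mp h
    nlinarith [hpos b hb0]
  have hA2' : A.card = 2 := by omega
  -- Both supports have exactly two elements, so the lower bound on the form at a is 0. Every cross
  -- entry between the supports then vanishes, against connectedness.
  have hab0 : a ⬝ᵥ G *ᵥ b = 0 := by
    refine le_antisymm hab (le_trans ?_ haa)
    rw [← hA, hA2'] at hA2
    simpa using hA2
  have huniv : A ∪ C = Finset.univ := by
    apply Finset.eq_univ_of_card
    rw [Finset.card_union_of_disjoint hAC]
    have := Finset.card_le_univ (A ∪ C)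
    rw [Finset.card_union_of_disjoint hAC] at this
    omega
  obtain ⟨i, hi⟩ := Finset.card_pos.mp (show 0 < A.card by omega)
  obtain ⟨j, hj⟩ := Finset.card_pos.mp (show 0 < C.card by omega)
  obtain ⟨i, hi, j, hj, hij⟩ := hconn (A : Set n) ⟨i, hi⟩
    ⟨j, fun h => Finset.disjoint_left.mp hAC h hj⟩
  have hjC : j ∈ C := by
    have := Finset.mem_univ j
    rw [← huniv, Finset.mem_union] at this
    exact this.resolve_left hj
  rw [dotProduct_mulVec_eq_sum] at hab0
  have h1 := (Finset.sum_eq_zero_iff_of_nonpos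
    fun i _ => Finset.sum_nonpos fun j _ => hterm i j).mp hab0 i (Finset.mem_univ i)
  have h2 := (Finset.sum_eq_zero_iff_of_nonpos fun j _ => hterm i j).mp h1 j (Finset.mem_univ j)
  have hai : a i ≠ 0 := (Finset.mem_filter.mp hi).2
  have hbj : b j ≠ 0 := (Finset.mem_filter.mp hjC).2
  exact mul_ne_zero (mul_ne_zero hai hij) hbj h2

/-- Pairing the eigenvalue equation with the positive and negative parts of x, which are orthogonal,
and using μ ≤ 0 gives exactly the inequalities of `false_of_disjoint_nonpos`. -/
theorem nonneg_or_nonpos_of_eigenvector (hsymm : G.IsSymm) (hcard : Fintype.card n ≤ 4)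
    (hdiag : ∀ i, G i i = 1)
    (hge : ∀ i j, -1 ≤ G i j) (hle : ∀ i j, i ≠ j → G i j ≤ 0)
    (hconn : ∀ A : Set n, A.Nonempty → Aᶜ.Nonempty → ∃ i ∈ A, ∃ j ∉ A, G i j ≠ 0)
    {x : n → ℝ} {μ : ℝ} (hx : G *ᵥ x = μ • x) (hμ : μ ≤ 0) : 0 ≤ x ∨ x ≤ 0 := by
  by_contra! h
  have hxp : x⁺ ≠ 0 := fun h0 => h.2 (posPart_eq_zero.mp h0)
  have hxm : x⁻ ≠ 0 := fun h0 => h.1 (negPart_eq_zero.mp h0)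
  have hdec : x = x⁺ - x⁻ := (posPart_sub_negPart x).symm
  have hdisj : ∀ i, x⁺ i = 0 ∨ x⁻ i = 0 := by
    intro i
    rw [Pi.posPart_apply, Pi.negPart_apply]
    rcases le_total 0 (x i) with h | h
    · exact Or.inr (negPart_eq_zero.mpr h)
    · exact Or.inl (posPart_eq_zero.mpr h)
  have hcomm : x⁻ ⬝ᵥ G *ᵥ x⁺ = x⁺ ⬝ᵥ G *ᵥ x⁻ := by
    rw [dotProduct_mulVec, ← mulVec_transpose, hsymm.eq, dotProduct_comm]
  have hpm : x⁺ ⬝ᵥ x⁻ = 0 := Finset.sum_eq_zero fun i _ => by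
    rcases hdisj i with h | h <;> simp [h]
  have hsq : ∀ c : n → ℝ, 0 ≤ c ⬝ᵥ c := fun c => Finset.sum_nonneg fun i _ => mul_self_nonneg _
  have e1 : x⁺ ⬝ᵥ G *ᵥ x = μ * (x⁺ ⬝ᵥ x⁺) := by
    rw [hx, dotProduct_smul, smul_eq_mul]
    nth_rewrite 2 [hdec]
    rw [dotProduct_sub, hpm, sub_zero]
  have e2 : x⁻ ⬝ᵥ G *ᵥ x = -(μ * (x⁻ ⬝ᵥ x⁻)) := by
    rw [hx, dotProduct_smul, smul_eq_mul]
    nth_rewrite 2 [hdec]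
    rw [dotProduct_sub, dotProduct_comm x⁻ x⁺, hpm, zero_sub, mul_neg]
  rw [hdec, mulVec_sub, dotProduct_sub, ← hdec] at e1 e2
  refine false_of_disjoint_nonpos hcard hdiag hge hle hconn (posPart_nonneg x) (negPart_nonneg x)
    hxp hxm hdisj ?_ ?_
  · nlinarith [hsq x⁺]
  · nlinarith [hsq x⁻]

/-- Both eigenvectors have constant sign, so orthogonality forces disjoint supports. -/
theorem false_of_orthogonal_eigenvectors (hsymm : G.IsSymm) (hcard : Fintype.card n ≤ 4)
    (hdiag : ∀ i, G i i = 1)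
    (hge : ∀ i j, -1 ≤ G i j) (hle : ∀ i j, i ≠ j → G i j ≤ 0)
    (hconn : ∀ A : Set n, A.Nonempty → Aᶜ.Nonempty → ∃ i ∈ A, ∃ j ∉ A, G i j ≠ 0)
    {x y : n → ℝ} {μ ν : ℝ} (hx : G *ᵥ x = μ • x) (hy : G *ᵥ y = ν • y) (hμ : μ ≤ 0) (hν : ν ≤ 0)
    (hx0 : x ≠ 0) (hy0 : y ≠ 0) (hxy : x ⬝ᵥ y = 0) : False := by
  have key : ∀ x y : n → ℝ, G *ᵥ x = μ • x → G *ᵥ y = ν • y → x ≠ 0 → y ≠ 0 → x ⬝ᵥ y = 0 →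
      0 ≤ x → 0 ≤ y → False := by
    intro x y hx hy hx0 hy0 hxy hxn hyn
    have hdisj : ∀ i, x i = 0 ∨ y i = 0 := fun i => mul_eq_zero.mp
      ((Finset.sum_eq_zero_iff_of_nonneg fun i _ => mul_nonneg (hxn i) (hyn i)).mp hxy i
        (Finset.mem_univ i))
    have hsq : ∀ c : n → ℝ, 0 ≤ c ⬝ᵥ c := fun c => Finset.sum_nonneg fun i _ => mul_self_nonneg _
    refine false_of_disjoint_nonpos hcard hdiag hge hle hconn hxn hyn hx0 hy0 hdisj ?_ ?_
    · rw [hx, hy, dotProduct_smul, dotProduct_smul, hxy, smul_zero, smul_eq_mul]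
      exact mul_nonpos_of_nonpos_of_nonneg hμ (hsq x)
    · rw [hy, dotProduct_smul, dotProduct_smul, hxy, smul_zero, smul_eq_mul]
      exact mul_nonpos_of_nonpos_of_nonneg hν (hsq y)
  rcases nonneg_or_nonpos_of_eigenvector hsymm hcard hdiag hge hle hconn hx hμ with h1 | h1 <;>
  rcases nonneg_or_nonpos_of_eigenvector hsymm hcard hdiag hge hle hconn hy hν with h2 | h2
  · exact key x y hx hy hx0 hy0 hxy h1 h2
  · exact key x (-y) hx (by rw [mulVec_neg, hy, smul_neg]) hx0 (neg_ne_zero.mpr hy0)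
      (by rw [dotProduct_neg, hxy, neg_zero]) h1 (neg_nonneg.mpr h2)
  · exact key (-x) y (by rw [mulVec_neg, hx, smul_neg]) hy (neg_ne_zero.mpr hx0) hy0
      (by rw [neg_dotProduct, hxy, neg_zero]) (neg_nonneg.mpr h1) h2
  · exact key (-x) (-y) (by rw [mulVec_neg, hx, smul_neg]) (by rw [mulVec_neg, hy, smul_neg])
      (neg_ne_zero.mpr hx0) (neg_ne_zero.mpr hy0)
      (by rw [neg_dotProduct, dotProduct_neg, hxy, neg_zero, neg_zero]) (neg_nonneg.mpr h1)
      (neg_nonneg.mpr h2)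

/-- An irreducible Gram form of size at most four has at most one nonpositive direction. -/
theorem card_le_sigPos_add_one (hsymm : G.IsSymm) (hcard : Fintype.card n ≤ 4)
    (hdiag : ∀ i, G i i = 1)
    (hge : ∀ i j, -1 ≤ G i j) (hle : ∀ i j, i ≠ j → G i j ≤ 0)
    (hconn : ∀ A : Set n, A.Nonempty → Aᶜ.Nonempty → ∃ i ∈ A, ∃ j ∉ A, G i j ≠ 0) :
    Fintype.card n ≤ sigPos (LinearMap.BilinMap.toQuadraticMap (Matrix.toBilin' G)) + 1 := by
  have hH : G.IsHermitian := by
    rw [Matrix.IsHermitian, conjTranspose_eq_transpose_of_trivial, hsymm.eq]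
  set b : Module.Basis n ℝ (n → ℝ) :=
    hH.eigenvectorBasis.toBasis.map (WithLp.linearEquiv 2 ℝ (n → ℝ)) with hb
  have heig : ∀ i, G *ᵥ b i = hH.eigenvalues i • b i := fun i => by
    simpa [b] using hH.mulVec_eigenvectorBasis i
  have hbb : ∀ i j, b i ⬝ᵥ b j = if i = j then 1 else 0 := fun i j => by
    have := orthonormal_iff_ite.mp hH.eigenvectorBasis.orthonormal j i
    rw [EuclideanSpace.inner_eq_star_dotProduct] at this
    simpa [b, eq_comm] using this
  have heq : (LinearMap.BilinMap.toQuadraticMap (Matrix.toBilin' G)).Equivalent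
      (QuadraticMap.weightedSumSquares ℝ hH.eigenvalues) := by
    refine ⟨{ b.equivFun with map_app' := fun x => ?_ }⟩
    have hx : G *ᵥ x = ∑ i, (b.equivFun x i * hH.eigenvalues i) • b i := by
      conv_lhs => rw [← b.sum_equivFun x, mulVec_sum]
      simp only [mulVec_smul, heig, smul_smul]
    change QuadraticMap.weightedSumSquares ℝ hH.eigenvalues (b.equivFun x) = _
    rw [LinearMap.BilinMap.toQuadraticMap_apply, Matrix.toBilin'_apply', hx,
      QuadraticMap.weightedSumSquares_apply]
    have hxb : ∀ i, x ⬝ᵥ b i = b.equivFun x i := fun i => by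
      conv_lhs => rw [← b.sum_equivFun x]
      simp only [sum_dotProduct, smul_dotProduct, hbb, smul_eq_mul, mul_ite, mul_one, mul_zero,
        Finset.sum_ite_eq', Finset.mem_univ, if_true]
    simp only [dotProduct_sum, dotProduct_smul, smul_eq_mul, hxb]
    refine Finset.sum_congr rfl fun i _ => ?_
    ring
  rw [QuadraticForm.sigPos_of_equiv_weightedSumSquares heq]
  have hsub : {i | 0 < hH.eigenvalues i}ᶜ.ncard ≤ 1 := by
    rw [Set.ncard_le_one]
    intro i hi j hj
    by_contra hij
    refine false_of_orthogonal_eigenvectors hsymm hcard hdiag hge hle hconn (heig i) (heig j)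
      (not_lt.mp hi) (not_lt.mp hj) (b.ne_zero i) (b.ne_zero j) ?_
    rw [hbb, if_neg hij]
  have := Set.ncard_add_ncard_compl {i | 0 < hH.eigenvalues i}
  rw [Nat.card_eq_fintype_card] at this
  omega

end SmallGram

/-- A connected graph with at least `k` vertices contains a connected induced subgraph on `k`
vertices. -/
theorem SimpleGraph.Connected.exists_embedding_comap_connected {V : Type*} [Finite V]
    {G : SimpleGraph V} (hG : G.Connected) {k : ℕ} (hk : 1 ≤ k) (hkV : k ≤ Nat.card V) :
    ∃ f : Fin k ↪ V, (G.comap f).Connected := by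
  induction hn : Nat.card V using Nat.strong_induction_on generalizing V with
  | _ n ih =>
  rcases hkV.eq_or_lt with h | h
  · have e : Fin k ≃ V := (finCongr h).trans (Finite.equivFin V).symm
    exact ⟨e.toEmbedding, (SimpleGraph.Iso.comap e G).connected_iff.mpr hG⟩
  · have : Nontrivial V := Finite.one_lt_card_iff_nontrivial.mp (by omega)
    obtain ⟨v, hv⟩ := hG.exists_connected_induce_compl_singleton_of_finite_nontrivial
    have hc : Nat.card ({v}ᶜ : Set V) + 1 = Nat.card V := by
      have := Set.ncard_add_ncard_compl ({v} : Set V)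
      rw [Set.ncard_singleton, ← Nat.card_coe_set_eq] at this
      omega
    obtain ⟨f, hf⟩ := ih _ (by omega) hv (by omega) rfl
    exact ⟨f.trans (Function.Embedding.subtype _), hf⟩

theorem SimpleGraph.Connected.exists_adj_mem_notMem {V : Type*} {G : SimpleGraph V}
    (hG : G.Connected) {A : Set V} (hA : A.Nonempty) (hA' : Aᶜ.Nonempty) :
    ∃ i ∈ A, ∃ j ∉ A, G.Adj i j := by
  obtain ⟨a, ha⟩ := hA
  obtain ⟨b, hb⟩ := hA'
  obtain ⟨p⟩ := hG.preconnected a b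
  induction p with
  | nil => exact absurd ha hb
  | @cons u v w h p ih =>
    by_cases hv : v ∈ A
    · exact ih hv hb
    · exact ⟨u, ha, v, hv, h⟩

theorem sigPos_le_of_injective {V V' : Type*} [AddCommGroup V] [Module ℝ V] [FiniteDimensional ℝ V]
    [AddCommGroup V'] [Module ℝ V'] [FiniteDimensional ℝ V'] {Q : QuadraticForm ℝ V}
    {Q' : QuadraticForm ℝ V'} (f : V →ₗ[ℝ] V') (hf : Function.Injective f)
    (hQ : ∀ v, Q' (f v) = Q v) : sigPos Q ≤ sigPos Q' := by
  obtain ⟨U, hU, hpos⟩ := exists_finrank_eq_sigPos_and_posDef Q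
  rw [← hU, (Submodule.equivMapOfInjective f hf U).finrank_eq]
  apply le_sigPos_of_posDef
  rintro ⟨_, ⟨u, hu, rfl⟩⟩ h0
  change 0 < Q' (f u)
  rw [hQ]
  exact hpos ⟨u, hu⟩ fun h => h0 (by
    have : u = 0 := congrArg Subtype.val h
    subst this
    simp)

/-! ### The signature of the Tits form. -/

namespace CoxeterMatrix

variable {S : Type*} [Fintype S] [DecidableEq S] {M : CoxeterMatrix S}

/-- A connected induced subgraph on k vertices spans a subspace whose Gram matrix satisfies
`card_le_sigPos_add_one`. -/
theorem le_sigPos_add_one (hirr : M.IsIrreducible) {k : ℕ} (hk : 1 ≤ k) (hk4 : k ≤ 4)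
    (hkS : k ≤ Fintype.card S) :
    k ≤ sigPos (LinearMap.BilinMap.toQuadraticMap M.titsForm) + 1 := by
  obtain ⟨f, hf⟩ := SimpleGraph.Connected.exists_embedding_comap_connected hirr hk
    (by rwa [Nat.card_eq_fintype_card])
  set G : Matrix (Fin k) (Fin k) ℝ := M.titsMatrix.submatrix f f with hG
  have h1 : k ≤ sigPos (LinearMap.BilinMap.toQuadraticMap (Matrix.toBilin' G)) + 1 := by
    have := card_le_sigPos_add_one (G := G) (Matrix.IsSymm.ext fun i j => M.titsMatrix_symm _ _)
      (by simpa using hk4) (fun i => M.titsMatrix_diag _) (fun i j => M.neg_one_le_titsMatrix _ _)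
      (fun i j hij => M.titsMatrix_nonpos (f.injective.ne hij)) ?_
    · simpa using this
    · intro A hA hA'
      obtain ⟨i, hi, j, hj, hij⟩ := hf.exists_adj_mem_notMem hA hA'
      exact ⟨i, hi, j, hj, (M.titsMatrix_neg hij).ne⟩
  refine h1.trans (Nat.add_le_add_right ?_ 1)
  let ι : (Fin k → ℝ) →ₗ[ℝ] (S → ℝ) := Fintype.linearCombination ℝ fun i => M.simpleRoot (f i)
  have hι : ∀ x, ι x = ∑ i, x i • M.simpleRoot (f i) := fun x =>
    Fintype.linearCombination_apply _ _ _
  refine sigPos_le_of_injective ι ?_ fun x => ?_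
  · intro x y hxy
    funext i
    have := congrFun hxy (f i)
    simpa [hι, simpleRoot_apply] using this
  · rw [LinearMap.BilinMap.toQuadraticMap_apply, LinearMap.BilinMap.toQuadraticMap_apply, hι,
      Matrix.toBilin'_apply]
    simp only [map_sum, map_smul, LinearMap.sum_apply, LinearMap.smul_apply, titsForm_simpleRoot,
      smul_eq_mul, Finset.mul_sum]
    rw [Finset.sum_comm]
    refine Finset.sum_congr rfl fun i _ => Finset.sum_congr rfl fun j _ => ?_
    rw [hG, Matrix.submatrix_apply]
    ring

theorem titsForm_self_nonneg_of_sigNeg_eq_zero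
    (h : sigNeg (LinearMap.BilinMap.toQuadraticMap M.titsForm) = 0) (v : S → ℝ) :
    0 ≤ M.titsForm v v := by
  by_contra! hv
  have hv0 : v ≠ 0 := by rintro rfl; simp at hv
  have := le_sigNeg_of_negDef (LinearMap.BilinMap.toQuadraticMap M.titsForm)
    (V := Submodule.span ℝ {v}) ?_
  · rw [finrank_span_singleton hv0, h] at this
    omega
  · rintro ⟨u, hu⟩ hu0
    obtain ⟨c, rfl⟩ := Submodule.mem_span_singleton.mp hu
    have hc : c ≠ 0 := by rintro rfl; exact hu0 (by simp)
    change 0 < -(M.titsForm (c • v) (c • v))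
    simp only [map_smul, LinearMap.smul_apply, smul_eq_mul]
    have : 0 < c ^ 2 := by positivity
    nlinarith

theorem sigNeg_eq_zero_of_nonneg (h : ∀ v, 0 ≤ M.titsForm v v) :
    sigNeg (LinearMap.BilinMap.toQuadraticMap M.titsForm) = 0 := by
  obtain ⟨U, hU, hneg⟩ := exists_finrank_eq_sigNeg_and_negDef
    (LinearMap.BilinMap.toQuadraticMap M.titsForm)
  rw [← hU]
  have : U = ⊥ := by
    rw [eq_bot_iff]
    intro u hu
    by_contra h0
    have h1 := hneg ⟨u, hu⟩ fun h => h0 (congrArg Subtype.val h)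
    change 0 < -(M.titsForm u u) at h1
    linarith [h u]
  rw [this, finrank_bot]

theorem titsForm_self_nonneg_of_card_le_two (h : Fintype.card S ≤ 2) (v : S → ℝ) :
    0 ≤ M.titsForm v v := by
  refine le_trans ?_ (M.titsForm_abs_le v)
  have h1 := two_sub_card_mul_le (G := M.titsMatrix) M.titsMatrix_diag M.neg_one_le_titsMatrix
    (abs_nonneg v)
  rw [titsForm, Matrix.toBilin'_apply']
  refine le_trans ?_ h1
  have h2 : ((Finset.univ.filter fun i => |v| i ≠ 0).card : ℝ) ≤ 2 := by
    exact_mod_cast (Finset.card_le_univ _).trans h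
  exact mul_nonneg (by linarith) (Finset.sum_nonneg fun i _ => sq_nonneg _)

end CoxeterMatrix

/-- The signature of the Tits form of an irreducible Coxeter group that is neither finite nor
affine. -/
theorem CoxeterSystem.signature_bounds {S W : Type*} [Fintype S] [DecidableEq S] [Group W]
    {M : CoxeterMatrix S} (cs : CoxeterSystem M W) (hirr : M.IsIrreducible)
    (hfin : ¬ Finite W) (haff : ¬ IsAffineGroup W) :
    1 ≤ sigNeg (LinearMap.BilinMap.toQuadraticMap M.titsForm) ∧
      (3 ≤ sigPos (LinearMap.BilinMap.toQuadraticMap M.titsForm) ∨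
        sigPos (LinearMap.BilinMap.toQuadraticMap M.titsForm) = 2 ∧
        sigNeg (LinearMap.BilinMap.toQuadraticMap M.titsForm) = 1) := by
  have hq : 1 ≤ sigNeg (LinearMap.BilinMap.toQuadraticMap M.titsForm) := by
    by_contra! h
    rcases cs.finite_or_isAffineGroup hirr
      (CoxeterMatrix.titsForm_self_nonneg_of_sigNeg_eq_zero (by omega)) with h | h
    · exact hfin h
    · exact haff h
  refine ⟨hq, ?_⟩
  have h3 : 3 ≤ Fintype.card S := by
    by_contra! h
    rw [CoxeterMatrix.sigNeg_eq_zero_of_nonneg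
      (CoxeterMatrix.titsForm_self_nonneg_of_card_le_two (by omega))] at hq
    omega
  -- With three generators p ≥ 2 and q ≥ 1 exhaust the dimension; with more, a connected subgraph on
  -- four vertices gives p ≥ 3.
  rcases h3.eq_or_lt with h | h
  · have h1 := CoxeterMatrix.le_sigPos_add_one hirr (k := 3) (by omega) (by omega) h3
    have h2 := QuadraticForm.sigPos_add_sigNeg_add_radical
      (Q := LinearMap.BilinMap.toQuadraticMap M.titsForm)
    rw [Module.finrank_fintype_fun_eq_card] at h2
    omega
  · have h1 := CoxeterMatrix.le_sigPos_add_one hirr (k := 4) (by omega) (by omega) h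
    omega

/-! ### Ideals of the skew matrices of a diagonal form. -/

namespace DiagonalForm

open Matrix

variable {ι : Type*} [Fintype ι] [DecidableEq ι] {ε : ι → ℝ}

/-- The Lie algebra of the matrices that are skew for the diagonal form with entries `ε`. -/
abbrev skew (ε : ι → ℝ) : LieSubalgebra ℝ (Matrix ι ι ℝ) :=
  skewAdjointMatricesLieSubalgebra (Matrix.diagonal ε)

theorem mem_skew_iff {X : Matrix ι ι ℝ} :
    X ∈ skew ε ↔ ∀ i j, ε i * X i j = -(ε j * X j i) := by
  rw [mem_skewAdjointMatricesLieSubalgebra, mem_skewAdjointMatricesSubmodule,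
    Matrix.IsSkewAdjoint, Matrix.IsAdjointPair, ← Matrix.ext_iff]
  simp only [mul_diagonal, diagonal_mul, transpose_apply, Matrix.neg_apply]
  refine forall_congr' fun i => forall_congr' fun j => ?_
  constructor <;> intro h <;> linarith

/-- The standard generator `e_i ∧ e_j` of the skew matrices. -/
def gen (ε : ι → ℝ) (i j : ι) : Matrix ι ι ℝ := fun k l =>
  (if k = i then if l = j then ε j else 0 else 0) - (if k = j then if l = i then ε i else 0 else 0)

omit [Fintype ι] in
theorem gen_apply (i j k l : ι) : gen ε i j k l =
    (if k = i then if l = j then ε j else 0 else 0) -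
      (if k = j then if l = i then ε i else 0 else 0) := rfl

omit [Fintype ι] in
theorem gen_self (i : ι) : gen ε i i = 0 := by
  ext k l
  simp [gen_apply]

omit [Fintype ι] in
theorem gen_swap (i j : ι) : gen ε j i = -gen ε i j := by
  ext k l
  simp [gen_apply]

omit [Fintype ι] in
theorem gen_apply_eq_zero {i j m n : ι} (h : ¬ ((m = i ∧ n = j) ∨ (m = j ∧ n = i))) :
    gen ε i j m n = 0 := by
  rw [gen_apply]
  split_ifs <;> simp_all

theorem gen_mem_skew (i j : ι) : gen ε i j ∈ skew ε := by
  rw [mem_skew_iff]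
  intro k l
  simp only [gen_apply]
  split_ifs <;> simp_all [mul_comm]

theorem gen_mul_apply (a b : ι) (X : Matrix ι ι ℝ) (i j : ι) :
    (gen ε a b * X) i j =
      (if i = a then ε b * X b j else 0) - (if i = b then ε a * X a j else 0) := by
  simp only [mul_apply, gen_apply, sub_mul, Finset.sum_sub_distrib]
  congr 1
  · split_ifs <;> simp
  · split_ifs <;> simp

theorem mul_gen_apply (a b : ι) (X : Matrix ι ι ℝ) (i j : ι) :
    (X * gen ε a b) i j =
      (if j = b then ε b * X i a else 0) - (if j = a then ε a * X i b else 0) := by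
  simp only [mul_apply, gen_apply, mul_sub, Finset.sum_sub_distrib]
  congr 1
  · split_ifs <;> simp [mul_comm]
  · split_ifs <;> simp [mul_comm]

theorem gen_lie {a b c : ι} (hab : a ≠ b) (hbc : b ≠ c) (hac : a ≠ c) :
    ⁅gen ε a b, gen ε b c⁆ = ε b • gen ε a c := by
  ext i j
  rw [Ring.lie_def, Matrix.sub_apply, gen_mul_apply, gen_mul_apply, Matrix.smul_apply, smul_eq_mul]
  simp only [gen_apply]
  split_ifs <;> simp_all

/-- The sign `-1` at `a` and `b`, and `1` elsewhere. -/
def flipSign (a b k : ι) : ℝ := if k = a ∨ k = b then -1 else 1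

/-- Entries with exactly one index in {a, b} are multiplied by -ε_a ε_b under the double bracket,
the others are killed. So conjugation by a double sign change is a polynomial in ad of a generator
and preserves ideals. -/
theorem lie_lie_gen_apply {a b : ι} (hab : a ≠ b) {X : Matrix ι ι ℝ} (hX : X ∈ skew ε)
    (hε : ∀ i, ε i * ε i = 1) (i j : ι) :
    X i j + 2 * (ε a * ε b) * ⁅gen ε a b, ⁅gen ε a b, X⁆⁆ i j =
      flipSign a b i * flipSign a b j * X i j := by
  rw [mem_skew_iff] at hX
  have hd : ∀ k, X k k = 0 := fun k => by
    have h1 := hX k k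
    have h2 := hε k
    have h3 : ε k * X k k = 0 := by linarith
    linear_combination ε k * h3 - X k k * h2
  have ha := hε a
  have hb := hε b
  have hs := hX a b
  have e : ⁅gen ε a b, ⁅gen ε a b, X⁆⁆ i j = (gen ε a b * (gen ε a b * X)) i j -
      (gen ε a b * (X * gen ε a b)) i j - ((gen ε a b * X) * gen ε a b) i j +
      ((X * gen ε a b) * gen ε a b) i j := by
    rw [Ring.lie_def, Ring.lie_def, mul_sub, sub_mul]
    simp only [Matrix.sub_apply]
    ring
  rw [e]
  clear e hX
  simp only [gen_mul_apply, mul_gen_apply, flipSign]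
  have hba := hab.symm
  rcases eq_or_ne i a with rfl | hia
  · rcases eq_or_ne j i with rfl | hja
    · simp [hd, hab, hba]
    rcases eq_or_ne j b with rfl | hjb
    · simp [hab, hba]
      right
      linear_combination (-2 * ε j) * hs
    · simp [hja, hjb, hab, hba]
      linear_combination (-2 * X i j) * (ε b * ε b * ha + hb)
  rcases eq_or_ne i b with rfl | hib
  · rcases eq_or_ne j a with rfl | hja
    · simp [hab, hba]
      right
      linear_combination (-2 * ε j) * hs
    rcases eq_or_ne j i with rfl | hjb
    · simp [hd, hab, hba]
    · simp [hja, hjb, hab, hba]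
      linear_combination (-2 * X i j) * (ε a * ε a * hb + ha)
  · rcases eq_or_ne j a with rfl | hja
    · simp [hia, hib, hab, hba]
      linear_combination (-2 * X i j) * (ε b * ε b * ha + hb)
    rcases eq_or_ne j b with rfl | hjb
    · simp [hia, hib, hab, hba]
      linear_combination (-2 * X i j) * (ε a * ε a * hb + ha)
    · simp [hia, hib, hja, hjb]

/-- A subspace of skew matrices that is stable under brackets and contains one generator contains
all of them. -/
theorem gen_mem_of_gen_mem (hε : ∀ i, ε i * ε i = 1) {J : Submodule ℝ (Matrix ι ι ℝ)}
    (hJ : ∀ Y ∈ skew ε, ∀ X ∈ J, ⁅Y, X⁆ ∈ J) {i j : ι} (hij : i ≠ j) (h : gen ε i j ∈ J) (k l : ι) :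
    gen ε k l ∈ J := by
  have hne : ∀ i, ε i ≠ 0 := fun i h => by simpa [h] using hε i
  have swap : ∀ {a b : ι}, gen ε a b ∈ J → gen ε b a ∈ J := fun {a b} h => by
    rw [gen_swap]; exact J.neg_mem h
  have step : ∀ {a b : ι} (c : ι), a ≠ b → gen ε a b ∈ J → gen ε c b ∈ J := fun {a b} c hab h => by
    rcases eq_or_ne c a with rfl | hca
    · exact h
    rcases eq_or_ne c b with rfl | hcb
    · rw [gen_self]; exact J.zero_mem
    have := hJ _ (gen_mem_skew c a) _ h
    rw [gen_lie hca hab hcb] at this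
    exact (J.smul_mem_iff (hne a)).mp this
  rcases eq_or_ne k j with rfl | hkj
  · exact swap (step l hij h)
  · exact swap (step l hkj.symm (swap (step k hij h)))

theorem skew_eq_sum_gen (hε : ∀ i, ε i * ε i = 1) {X : Matrix ι ι ℝ} (hX : X ∈ skew ε) :
    X = (2⁻¹ : ℝ) • ∑ i, ∑ j, (ε j * X i j) • gen ε i j := by
  rw [mem_skew_iff] at hX
  ext k l
  rw [Matrix.smul_apply, Matrix.sum_apply]
  simp only [Matrix.sum_apply, Matrix.smul_apply, gen_apply, smul_eq_mul, mul_sub,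
    Finset.sum_sub_distrib, mul_ite, mul_zero, Finset.sum_ite_eq,
    Finset.mem_univ, if_true]
  have h1 : ∑ x, ∑ y, (if k = x then if l = y then ε y * X x y * ε y else 0 else 0) = X k l := by
    rw [Finset.sum_eq_single k (fun x _ hx => by simp [hx.symm]) (by simp)]
    simp only [if_true, Finset.sum_ite_eq, Finset.mem_univ]
    linear_combination X k l * hε l
  rw [h1]
  linear_combination (2⁻¹ * ε k) * hX k l - (2⁻¹ * X k l) * hε k

/-- A nonzero subspace of skew matrices that is stable under brackets contains a generator, unless
the form is four-dimensional of positive discriminant. -/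
theorem exists_gen_mem (hε : ∀ i, ε i * ε i = 1)
    (h4 : ∀ i j k l, i ≠ j → k ≠ l → k ≠ i → k ≠ j → l ≠ i → l ≠ j →
      (∀ m, m = i ∨ m = j ∨ m = k ∨ m = l) → ε i * ε j * (ε k * ε l) = -1)
    {J : Submodule ℝ (Matrix ι ι ℝ)} (hJs : ∀ X ∈ J, X ∈ skew ε)
    (hJ : ∀ Y ∈ skew ε, ∀ X ∈ J, ⁅Y, X⁆ ∈ J) (hJ0 : J ≠ ⊥) :
    ∃ i j, i ≠ j ∧ gen ε i j ∈ J := by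
  classical
  have hne : ∀ i, ε i ≠ 0 := fun i h => by simpa [h] using hε i
  let supp : Matrix ι ι ℝ → Finset (ι × ι) := fun X => Finset.univ.filter fun p => X p.1 p.2 ≠ 0
  have hex : ∃ n, ∃ X ∈ J, X ≠ 0 ∧ (supp X).card = n := by
    obtain ⟨X, hX, h0⟩ := Submodule.exists_mem_ne_zero_of_ne_bot hJ0
    exact ⟨_, X, hX, h0, rfl⟩
  obtain ⟨X, hXJ, hX0, hcard⟩ := Nat.find_spec hex
  have hmin : ∀ Y ∈ J, Y ≠ 0 → (supp X).card ≤ (supp Y).card := fun Y hY hY0 => by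
    rw [hcard]; exact Nat.find_min' hex ⟨Y, hY, hY0, rfl⟩
  have hsk := mem_skew_iff.mp (hJs X hXJ)
  -- all entries of the support have the same sign under every double sign change
  have hsign : ∀ a b, a ≠ b → ∀ i j k l, X i j ≠ 0 → X k l ≠ 0 →
      flipSign a b i * flipSign a b j = 1 → flipSign a b k * flipSign a b l = 1 := by
    intro a b hab i j k l hij hkl h1
    have hfs : ∀ m, flipSign a b m = 1 ∨ flipSign a b m = -1 := fun m => by
      unfold flipSign; split_ifs <;> simp
    by_contra hne1
    have h2 : flipSign a b k * flipSign a b l = -1 := by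
      rcases hfs k with h | h <;> rcases hfs l with h' | h' <;> simp_all
    set Z := ⁅gen ε a b, ⁅gen ε a b, X⁆⁆ with hZ
    have hZJ : Z ∈ J := hJ _ (gen_mem_skew a b) _ (hJ _ (gen_mem_skew a b) _ hXJ)
    -- Adding to X its conjugate by the sign change doubles the entries of sign 1 and kills those of
    -- sign -1, which would contradict the minimality of the support.
    set Y := X + (X + (2 * (ε a * ε b)) • Z) with hY
    have hYJ : Y ∈ J := J.add_mem hXJ (J.add_mem hXJ (J.smul_mem _ hZJ))
    have hYa : ∀ m n, Y m n = (1 + flipSign a b m * flipSign a b n) * X m n := fun m n => by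
      have := lie_lie_gen_apply hab (hJs X hXJ) hε m n
      rw [hY, Matrix.add_apply, Matrix.add_apply, Matrix.smul_apply, smul_eq_mul, this]
      ring
    have hY0 : Y ≠ 0 := by
      intro h
      have := hYa i j
      rw [h, h1, Matrix.zero_apply] at this
      apply hij
      linarith
    have hlt : (supp Y).card < (supp X).card := by
      apply Finset.card_lt_card
      rw [Finset.ssubset_iff_of_subset]
      · refine ⟨(k, l), by simpa [supp] using hkl, ?_⟩
        simp [supp, hYa, h2]
      · intro p hp
        simp only [supp, Finset.mem_filter, Finset.mem_univ, true_and, hYa] at hp ⊢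
        exact right_ne_zero_of_mul hp
    exact absurd (hmin Y hYJ hY0) (not_le.mpr hlt)
  have hdiag : ∀ k l, X k l ≠ 0 → k ≠ l := by
    rintro k l h rfl
    have := hsk k k
    have h3 : ε k * X k k = 0 := by linarith
    exact mul_ne_zero (hne k) h h3
  obtain ⟨i, j, hij⟩ : ∃ i j, X i j ≠ 0 := by
    by_contra! h
    exact hX0 (Matrix.ext h)
  have hijne := hdiag i j hij
  -- the support lies in `{i, j}` and in its complement
  have hin : ∀ k l, X k l ≠ 0 → (k = i ∧ l = j) ∨ (k = j ∧ l = i) ∨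
      (k ≠ i ∧ k ≠ j ∧ l ≠ i ∧ l ≠ j ∧ ∀ m, m = i ∨ m = j ∨ m = k ∨ m = l) := by
    intro k l hkl
    have hklne := hdiag k l hkl
    have h1 := hsign i j hijne i j k l hij hkl (by simp [flipSign])
    by_cases hk : k = i ∨ k = j
    · have hl : l = i ∨ l = j := by
        by_contra hl
        simp only [flipSign, hk, hl, if_true, if_false] at h1
        norm_num at h1
      rcases hk with rfl | rfl <;> rcases hl with rfl | rfl <;> simp_all
    · have hl : ¬ (l = i ∨ l = j) := by
        intro hl
        simp only [flipSign, hk, hl, if_true, if_false] at h1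
        norm_num at h1
      push Not at hk hl
      refine Or.inr (Or.inr ⟨hk.1, hk.2, hl.1, hl.2, fun m => ?_⟩)
      by_contra! hm
      obtain ⟨hmi, hmj, hmk, hml⟩ := hm
      -- A fifth index m would give the sign change at i and m, which fixes the entry (k, l) and
      -- negates (i, j).
      have h2 := hsign i m hmi.symm k l i j hkl hij
        (by simp [flipSign, hk.1, hl.1, hmk.symm, hml.symm])
      simp [flipSign, hijne.symm, hmj.symm] at h2
      norm_num at h2
  have hcoef : ∀ k l, k ≠ l → ∀ m n, ((m = k ∧ n = l) ∨ (m = l ∧ n = k)) →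
      X m n = ((ε l * X k l) • gen ε k l) m n := by
    intro k l hkl m n h
    rw [Matrix.smul_apply, smul_eq_mul, gen_apply]
    rcases h with ⟨rfl, rfl⟩ | ⟨rfl, rfl⟩
    · simp [hkl]
      linear_combination (-X m n) * hε n
    · simp [hkl.symm]
      have := hsk m n
      linear_combination (ε m) * this - (X m n) * hε m
  by_cases hcase : ∃ k l, X k l ≠ 0 ∧ k ≠ i ∧ k ≠ j ∧ l ≠ i ∧ l ≠ j ∧
      ∀ m, m = i ∨ m = j ∨ m = k ∨ m = l
  · obtain ⟨k, l, hkl, hki, hkj, hli, hlj, hall⟩ := hcase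
    have hklne := hdiag k l hkl
    have hsgn := h4 i j k l hijne hklne hki hkj hli hlj hall
    set α := ε j * X i j with hα
    set β := ε l * X k l with hβ
    have hα0 : α ≠ 0 := mul_ne_zero (hne j) hij
    have hX : X = α • gen ε i j + β • gen ε k l := by
      ext m n
      rw [Matrix.add_apply]
      by_cases h1 : (m = i ∧ n = j) ∨ (m = j ∧ n = i)
      · rw [hcoef i j hijne m n h1]
        have : gen ε k l m n = 0 := gen_apply_eq_zero (by
          rcases h1 with ⟨rfl, rfl⟩ | ⟨rfl, rfl⟩ <;> simp [hki.symm, hkj.symm, hli.symm, hlj.symm])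
        rw [Matrix.smul_apply _ (gen ε k l), this]
        simp [hα]
      · rw [Matrix.smul_apply, gen_apply_eq_zero h1, smul_zero, zero_add]
        by_cases h2 : (m = k ∧ n = l) ∨ (m = l ∧ n = k)
        · exact hcoef k l hklne m n h2
        · rw [Matrix.smul_apply, gen_apply_eq_zero h2, smul_zero]
          by_contra h0
          have hmn := hdiag m n h0
          rcases hin m n h0 with h | h | ⟨c1, c2, c3, c4, -⟩
          · exact h1 (Or.inl h)
          · exact h1 (Or.inr h)
          · have a1 := (hall m).resolve_left c1 |>.resolve_left c2
            have a2 := (hall n).resolve_left c3 |>.resolve_left c4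
            rcases a1 with a1 | a1 <;> rcases a2 with a2 | a2
            · exact hmn (a1.trans a2.symm)
            · exact h2 (Or.inl ⟨a1, a2⟩)
            · exact h2 (Or.inr ⟨a1, a2⟩)
            · exact hmn (a1.trans a2.symm)
    have b1 : ⁅gen ε j l, gen ε i j⁆ = -(ε j • gen ε i l) := by
      rw [← lie_skew, gen_lie hijne hlj.symm hli.symm]
    have b2 : ⁅gen ε j l, gen ε k l⁆ = -(ε l • gen ε j k) := by
      rw [gen_swap l k, lie_neg, gen_lie hlj.symm hklne.symm hkj.symm]
    have b3 : ⁅gen ε i k, gen ε i l⁆ = -(ε i • gen ε k l) := by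
      rw [gen_swap k i, neg_lie, gen_lie hki hli.symm hklne]
    have b4 : ⁅gen ε i k, gen ε j k⁆ = -(ε k • gen ε i j) := by
      rw [gen_swap k j, lie_neg, gen_lie hki.symm hkj hijne]
    -- This double bracket exchanges the two generators up to sign, so a combination with X
    -- eliminates `gen ε k l`. The remaining coefficient is ±(α² + β²) because the product of the
    -- four signs is -1; for product 1 it would be ±(α² - β²), which can vanish.
    have hZ : ⁅gen ε i k, ⁅gen ε j l, X⁆⁆ =
        (α * (ε i * ε j)) • gen ε k l + (β * (ε k * ε l)) • gen ε i j := by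
      rw [hX, lie_add, lie_smul, lie_smul, b1, b2, lie_add, lie_smul, lie_smul, lie_neg, lie_neg,
        lie_smul, lie_smul, b3, b4]
      module
    have hZJ : ⁅gen ε i k, ⁅gen ε j l, X⁆⁆ ∈ J :=
      hJ _ (gen_mem_skew i k) _ (hJ _ (gen_mem_skew j l) _ hXJ)
    have hcomb : ((α ^ 2 + β ^ 2) * (ε i * ε j)) • gen ε i j ∈ J := by
      have h5 := J.sub_mem (J.smul_mem (α * (ε i * ε j)) hXJ) (J.smul_mem β hZJ)
      have hs' : ε k * ε l = -(ε i * ε j) := by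
        linear_combination (ε i * ε j) * hsgn - (ε k * ε l) * (ε j * ε j * hε i + hε j)
      have h6 : (α * (ε i * ε j)) • X - β • ⁅gen ε i k, ⁅gen ε j l, X⁆⁆ =
          ((α ^ 2 + β ^ 2) * (ε i * ε j)) • gen ε i j := by
        rw [hZ, hs']
        nth_rewrite 1 [hX]
        module
      rwa [h6] at h5
    refine ⟨i, j, hijne, (J.smul_mem_iff ?_).mp hcomb⟩
    have : 0 < α ^ 2 + β ^ 2 := by positivity
    exact mul_ne_zero this.ne' (mul_ne_zero (hne i) (hne j))
  · push Not at hcase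
    have hX : X = (ε j * X i j) • gen ε i j := by
      ext m n
      by_cases h1 : (m = i ∧ n = j) ∨ (m = j ∧ n = i)
      · exact hcoef i j hijne m n h1
      · rw [Matrix.smul_apply, gen_apply_eq_zero h1, smul_zero]
        by_contra h0
        rcases hin m n h0 with h | h | ⟨c1, c2, c3, c4, c5⟩
        · exact h1 (Or.inl h)
        · exact h1 (Or.inr h)
        · obtain ⟨x, hx1, hx2, hx3, hx4⟩ := hcase m n h0 c1 c2 c3 c4
          rcases c5 x with h | h | h | h <;> contradiction
    refine ⟨i, j, hijne, (J.smul_mem_iff (mul_ne_zero (hne j) hij)).mp ?_⟩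
    rw [← hX]
    exact hXJ

end DiagonalForm

/-! ### Simplicity of the skew matrices and irreducibility of their natural module. -/

namespace DiagonalForm

open Matrix

variable {ι : Type*} [Fintype ι] [DecidableEq ι] {ε : ι → ℝ}

theorem exists_ne_ne_of_three_le_card (hn : 3 ≤ Fintype.card ι) (a b : ι) : ∃ c, c ≠ a ∧ c ≠ b := by
  have : ({a, b} : Finset ι).card < Fintype.card ι := lt_of_le_of_lt Finset.card_le_two (by omega)
  obtain ⟨c, hc⟩ := Finset.exists_mem_notMem_of_card_lt_card (s := {a, b}) (t := Finset.univ) this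
  simp only [Finset.mem_insert, Finset.mem_singleton, not_or] at hc
  exact ⟨c, hc.2⟩

/-- The Lie algebra of skew matrices of a nondegenerate diagonal form in at least three variables is
simple, unless the form is four-dimensional of positive discriminant. -/
theorem isSimple_skew (hε : ∀ i, ε i * ε i = 1) (hn : 3 ≤ Fintype.card ι)
    (h4 : ∀ i j k l, i ≠ j → k ≠ l → k ≠ i → k ≠ j → l ≠ i → l ≠ j →
      (∀ m, m = i ∨ m = j ∨ m = k ∨ m = l) → ε i * ε j * (ε k * ε l) = -1) :
    LieAlgebra.IsSimple ℝ (skew ε) where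
  eq_bot_or_eq_top I := by
    rw [or_iff_not_imp_left]
    intro hI
    let J : Submodule ℝ (Matrix ι ι ℝ) :=
      I.toSubmodule.map (skew ε).toSubmodule.subtype
    have hmem : ∀ X : skew ε, X ∈ I ↔ (X : Matrix ι ι ℝ) ∈ J := fun X => by
      constructor
      · intro h
        exact ⟨X, h, rfl⟩
      · rintro ⟨Y, hY, hYX⟩
        have : Y = X := Subtype.ext hYX
        exact this ▸ hY
    have hJs : ∀ X ∈ J, X ∈ skew ε := by
      rintro _ ⟨Y, _, rfl⟩
      exact Y.2
    have hJ : ∀ Y ∈ skew ε, ∀ X ∈ J, ⁅Y, X⁆ ∈ J := by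
      intro Y hY X hX
      have h1 : (⟨X, hJs X hX⟩ : skew ε) ∈ I := (hmem _).mpr hX
      exact (hmem _).mp (lie_mem_right ℝ (skew ε) I ⟨Y, hY⟩ _ h1)
    have hJ0 : J ≠ ⊥ := by
      intro h
      apply hI
      rw [LieSubmodule.eq_bot_iff]
      intro X hX
      have := (hmem X).mp hX
      rw [h, Submodule.mem_bot] at this
      exact Subtype.ext this
    obtain ⟨i, j, hij, hg⟩ := exists_gen_mem hε h4 hJs hJ hJ0
    rw [eq_top_iff]
    intro X _
    rw [hmem, skew_eq_sum_gen hε X.2]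
    exact J.smul_mem _ (J.sum_mem fun k _ => J.sum_mem fun l _ =>
      J.smul_mem _ (gen_mem_of_gen_mem hε hJ hij hg k l))
  non_abelian h := by
    obtain ⟨a⟩ : Nonempty ι := Fintype.card_pos_iff.mp (by omega)
    obtain ⟨b, hba, -⟩ := exists_ne_ne_of_three_le_card hn a a
    obtain ⟨c, hca, hcb⟩ := exists_ne_ne_of_three_le_card hn a b
    have h1 := h.trivial ⟨gen ε a b, gen_mem_skew a b⟩ ⟨gen ε b c, gen_mem_skew b c⟩
    have h2 : ⁅gen ε a b, gen ε b c⁆ = 0 := congrArg Subtype.val h1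
    rw [gen_lie hba.symm hcb.symm hca.symm] at h2
    have h3 := congrFun (congrFun h2 a) c
    rw [Matrix.smul_apply, gen_apply] at h3
    have hb : ε b ≠ 0 := fun h => by simpa [h] using hε b
    have hc : ε c ≠ 0 := fun h => by simpa [h] using hε c
    simp [hca, hb, hc] at h3

theorem gen_mulVec (a b : ι) (v : ι → ℝ) :
    gen ε a b *ᵥ v = (ε b * v b) • Pi.single a 1 - (ε a * v a) • Pi.single b 1 := by
  ext k
  simp only [mulVec, dotProduct, gen_apply, sub_mul, Finset.sum_sub_distrib, Pi.sub_apply,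
    Pi.smul_apply, Pi.single_apply, smul_eq_mul]
  congr 1 <;> split_ifs <;> simp

/-- The natural representation of the skew matrices of a nondegenerate diagonal form in at least
three variables is irreducible. -/
theorem isIrreducible_skew (hε : ∀ i, ε i * ε i = 1) (hn : 3 ≤ Fintype.card ι) :
    LieModule.IsIrreducible ℝ (skew ε) (ι → ℝ) := by
  have hne : ∀ i, ε i ≠ 0 := fun i h => by simpa [h] using hε i
  have : Nonempty ι := Fintype.card_pos_iff.mp (by omega)
  refine LieModule.IsIrreducible.mk fun N hN => ?_
  have hgen : ∀ a b, ∀ v ∈ N, gen ε a b *ᵥ v ∈ N := fun a b v hv =>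
    N.lie_mem (x := (⟨gen ε a b, gen_mem_skew a b⟩ : skew ε)) hv
  obtain ⟨v, hv, hv0⟩ : ∃ v ∈ N, v ≠ 0 := by
    by_contra! h
    exact hN ((LieSubmodule.eq_bot_iff N).mpr h)
  obtain ⟨b, hb⟩ := Function.ne_iff.mp hv0
  obtain ⟨c, hcb, -⟩ := exists_ne_ne_of_three_le_card hn b b
  obtain ⟨a, hab, hac⟩ := exists_ne_ne_of_three_le_card hn b c
  have hc : (Pi.single c 1 : ι → ℝ) ∈ N := by
    -- With a, b, c distinct, the two generators send v to a multiple of the basis vector at c with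
    -- coefficient ε_a ε_b v_b, which is nonzero.
    have h1 := hgen c a _ (hgen a b v hv)
    rw [gen_mulVec, gen_mulVec] at h1
    simp [hab, hac.symm, hcb] at h1
    exact (N.toSubmodule.smul_mem_iff (mul_ne_zero (hne a) (mul_ne_zero (hne b) hb))).mp h1
  have hall : ∀ i, (Pi.single i 1 : ι → ℝ) ∈ N := by
    intro i
    rcases eq_or_ne i c with rfl | hic
    · exact hc
    have h1 := hgen i c _ hc
    rw [gen_mulVec] at h1
    simp [hic] at h1
    exact (N.toSubmodule.smul_mem_iff (hne c)).mp h1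
  rw [eq_top_iff]
  intro u _
  have hu : u = ∑ i, u i • (Pi.single i 1 : ι → ℝ) := by
    ext j
    simp [Pi.single_apply]
  rw [hu]
  exact N.toSubmodule.sum_mem fun i _ => N.toSubmodule.smul_mem _ (hall i)

theorem eq_zero_of_forall_mulVec_eq_zero (hε : ∀ i, ε i * ε i = 1) (hn : 3 ≤ Fintype.card ι)
    {v : ι → ℝ} (h : ∀ A ∈ skew ε, A *ᵥ v = 0) : v = 0 := by
  ext b
  obtain ⟨a, hab, -⟩ := exists_ne_ne_of_three_le_card hn b b
  have h1 := congrFun (h _ (gen_mem_skew a b)) a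
  rw [gen_mulVec] at h1
  have hb : ε b ≠ 0 := fun h => by simpa [h] using hε b
  simpa [hab, hb] using h1

end DiagonalForm

/-! ### Semidirect sums that are not presentable by a product. -/

section Presentable

open LieAlgebra

theorem LieIsPresentableByProduct.of_equiv {k L L' : Type*} [Field k] [LieRing L] [LieAlgebra k L]
    [LieRing L'] [LieAlgebra k L'] (e : L ≃ₗ⁅k⁆ L') (h : LieIsPresentableByProduct k L) :
    LieIsPresentableByProduct k L' := by
  obtain ⟨L₁, L₂, h1, h2, hcomm, hsum⟩ := h
  have hne : ∀ K : LieSubalgebra k L, K ≠ ⊥ → K.map e.toLieHom ≠ ⊥ := by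
    intro K hK hbot
    apply hK
    rw [LieSubalgebra.eq_bot_iff] at hbot ⊢
    intro x hx
    have := hbot (e x) ⟨x, hx, rfl⟩
    exact e.injective (this.trans (map_zero e).symm)
  refine ⟨L₁.map e.toLieHom, L₂.map e.toLieHom, hne L₁ h1, hne L₂ h2, ?_, ?_⟩
  · rintro _ ⟨x, hx, rfl⟩ _ ⟨y, hy, rfl⟩
    change ⁅e x, e y⁆ = 0
    rw [← LieEquiv.map_lie, hcomm x hx y hy, map_zero]
  · intro z
    obtain ⟨x, hx, y, hy, hxy⟩ := hsum (e.symm z)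
    refine ⟨e x, ⟨x, hx, rfl⟩, e y, ⟨y, hy, rfl⟩, ?_⟩
    rw [← map_add, hxy, e.apply_symm_apply]

variable {n : Type*} [Fintype n] [DecidableEq n] {r : ℕ} {𝔤 : LieSubalgebra ℝ (Matrix n n ℝ)}

/-- If the sum of two commuting subalgebras of a semidirect sum is everything, then they project
onto ideals. -/
theorem exists_lieIdeal_projr
    {L₁ L₂ : LieSubalgebra ℝ (SemiDirectSum (Fin r → n → ℝ) 𝔤 (diagonalAction r 𝔤))}
    (hcomm : ∀ x ∈ L₁, ∀ y ∈ L₂, ⁅x, y⁆ = 0) (hsum : ∀ z, ∃ x ∈ L₁, ∃ y ∈ L₂, x + y = z) :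
    ∃ I : LieIdeal ℝ 𝔤, ∀ A, A ∈ I ↔ ∃ x ∈ L₁, x.right = A := by
  let P := SemiDirectSum.projr (diagonalAction r 𝔤)
  refine ⟨{ L₁.toSubmodule.map (P : _ →ₗ[ℝ] 𝔤) with
    lie_mem := ?_ }, fun A => Iff.rfl⟩
  rintro A _ ⟨x, hx, rfl⟩
  obtain ⟨x', hx', y', hy', hz⟩ := hsum ⟨0, A⟩
  refine ⟨⁅x', x⁆, L₁.lie_mem hx' hx, ?_⟩
  -- The component y' of the lift of A commutes with x, so bracketing with A stays inside L₁.
  have h1 : ⁅(⟨0, A⟩ : SemiDirectSum (Fin r → n → ℝ) 𝔤 (diagonalAction r 𝔤)), x⁆ = ⁅x', x⁆ := by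
    rw [← hz, add_lie, ← lie_skew y' x, hcomm x hx y' hy', neg_zero, add_zero]
  rw [← h1]
  rfl

/-- A semidirect sum of a simple Lie algebra of matrices without common kernel with copies of its
natural module is not presentable by a product. -/
theorem not_lieIsPresentableByProduct_semiDirectSum (hs : LieAlgebra.IsSimple ℝ 𝔤)
    (hker : ∀ v : n → ℝ, (∀ A ∈ 𝔤, A.mulVec v = 0) → v = 0) :
    ¬ LieIsPresentableByProduct ℝ
      (SemiDirectSum (Fin r → n → ℝ) 𝔤 (diagonalAction r 𝔤)) := by
  have key : ∀ L₁ L₂ : LieSubalgebra ℝ (SemiDirectSum (Fin r → n → ℝ) 𝔤 (diagonalAction r 𝔤)),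
      L₁ ≠ ⊥ → (∀ x ∈ L₁, ∀ y ∈ L₂, ⁅x, y⁆ = 0) → (∀ z, ∃ x ∈ L₁, ∃ y ∈ L₂, x + y = z) →
      ∀ A : 𝔤, ∃ x ∈ L₁, x.right = A := by
    intro L₁ L₂ h1 hcomm hsum
    obtain ⟨I, hI⟩ := exists_lieIdeal_projr hcomm hsum
    rcases hs.eq_bot_or_eq_top I with hbot | htop
    · exfalso
      have h0 : ∀ x ∈ L₁, x.right = 0 := fun x hx => by
        have : x.right ∈ I := (hI _).mpr ⟨x, hx, rfl⟩
        rwa [hbot, LieSubmodule.mem_bot] at this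
      apply h1
      rw [LieSubalgebra.eq_bot_iff]
      intro x hx
      -- As L₁ projects to zero, L₂ contains a lift of every A. It commutes with x and the left
      -- summand is abelian, so every A kills each vector of `x.left`.
      have hleft : x.left = 0 := by
        funext i
        apply hker
        intro A hA
        obtain ⟨x', hx', y', hy', hz⟩ := hsum ⟨0, ⟨A, hA⟩⟩
        have hr : y'.right = ⟨A, hA⟩ := by
          have := congrArg SemiDirectSum.right hz
          simpa [h0 x' hx'] using this
        have h2 := congrArg SemiDirectSum.left (hcomm x hx y' hy')
        have h3 := congrFun h2 i
        simp only [SemiDirectSum.lie_eq_mk, h0 x hx, hr, map_zero] at h3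
        have h4 : ⁅x.left, y'.left⁆ = 0 := by rw [Ring.lie_def, mul_comm, sub_self]
        rw [h4] at h3
        simpa [diagonalAction] using h3
      ext1
      · exact hleft
      · exact h0 x hx
    · intro A
      exact (hI A).mp (htop ▸ LieSubmodule.mem_top A)
  rintro ⟨L₁, L₂, h1, h2, hcomm, hsum⟩
  have k1 := key L₁ L₂ h1 hcomm hsum
  have k2 := key L₂ L₁ h2 (fun x hx y hy => by rw [← lie_skew, hcomm y hy x hx, neg_zero])
    (fun z => by
      obtain ⟨x, hx, y, hy, h⟩ := hsum z
      exact ⟨y, hy, x, hx, by rw [← h]; exact add_comm y x⟩)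
  apply hs.non_abelian
  refine ⟨fun A A' => ?_⟩
  obtain ⟨x, hx, rfl⟩ := k1 A
  obtain ⟨y, hy, rfl⟩ := k2 A'
  exact congrArg SemiDirectSum.right (hcomm x hx y hy)

end Presentable

/-! ### Sylvester's normal form with the kernel split off. -/

section Inertia

/-- The diagonal entries of the normal form of a real quadratic form with signature `(p, q)`. -/
def signs (p q : ℕ) : Fin p ⊕ Fin q → ℝ := Sum.elim (fun _ => 1) fun _ => -1

theorem signs_mul_self {p q : ℕ} (i : Fin p ⊕ Fin q) : signs p q i * signs p q i = 1 := by
  rcases i with i | i <;> simp [signs]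

variable {E : Type*} [AddCommGroup E] [Module ℝ E] [FiniteDimensional ℝ E]

/-- Sylvester's law of inertia, in terms of a basis. -/
theorem exists_basis_signs (B : LinearMap.BilinForm ℝ E) (hB : ∀ v w, B v w = B w v) {p q r : ℕ}
    (hp : p = sigPos (LinearMap.BilinMap.toQuadraticMap B))
    (hq : q = sigNeg (LinearMap.BilinMap.toQuadraticMap B))
    (hr : r = Module.finrank ℝ (LinearMap.ker B)) :
    ∃ b : Module.Basis ((Fin p ⊕ Fin q) ⊕ Fin r) ℝ E,
      ∀ i j, B (b i) (b j) = if i = j then Sum.elim (signs p q) (fun _ => 0) i else 0 := by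
  set Q := LinearMap.BilinMap.toQuadraticMap B with hQ
  obtain ⟨w, hw⟩ := QuadraticForm.equivalent_signType_weighted_sum_squared Q
  rw [QuadraticForm.sigPos_of_equiv_weightedSumSquares hw] at hp
  rw [QuadraticForm.sigNeg_of_equiv_weightedSumSquares hw] at hq
  have hassoc : QuadraticMap.associated (R := ℝ) Q = B :=
    QuadraticMap.associated_left_inverse ℝ hB
  have hr' : r = {i | ((w i : SignType) : ℝ) = 0}.ncard := by
    rw [hr, ← QuadraticForm.finrank_radical_of_equiv_weightedSumSquares hw,
      QuadraticMap.radical_eq_ker_associated, hassoc]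
  obtain ⟨e⟩ := hw
  let f₁ : Fin p ≃ {i | (0 : ℝ) < w i} := (Finite.equivFinOfCardEq hp.symm).symm
  let f₂ : Fin q ≃ {i | (w i : ℝ) < 0} := (Finite.equivFinOfCardEq hq.symm).symm
  let f₃ : Fin r ≃ {i | (w i : ℝ) = 0} := (Finite.equivFinOfCardEq hr'.symm).symm
  let g : (Fin p ⊕ Fin q) ⊕ Fin r → Fin (Module.finrank ℝ E) :=
    Sum.elim (Sum.elim (fun i => (f₁ i).1) fun i => (f₂ i).1) fun i => (f₃ i).1
  have hwg : ∀ i, (w (g i) : ℝ) = Sum.elim (signs p q) (fun _ => 0) i := by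
    have hs : ∀ s : SignType, ((0 : ℝ) < s → (s : ℝ) = 1) ∧ ((s : ℝ) < 0 → (s : ℝ) = -1) := by
      intro s
      cases s <;> norm_num
    rintro ((i | i) | i)
    · exact (hs _).1 (f₁ i).2
    · exact (hs _).2 (f₂ i).2
    · exact (f₃ i).2
  have hg : Function.Bijective g := by
    constructor
    · have h1 := fun i => (f₁ i).2
      have h2 := fun i => (f₂ i).2
      have h3 := fun i => (f₃ i).2
      simp only [Set.mem_ofPred_eq] at h1 h2 h3
      intro i j hij
      have h := hwg i
      rw [hij, hwg j] at h
      rcases i with (i | i) | i <;> rcases j with (j | j) | j <;> simp [signs] at h <;>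
        first
        | exact congrArg _ (congrArg _ (f₁.injective (Subtype.ext hij)))
        | exact congrArg _ (congrArg _ (f₂.injective (Subtype.ext hij)))
        | exact congrArg _ (f₃.injective (Subtype.ext hij))
        | (exfalso; linarith)
    · intro k
      rcases lt_trichotomy (w k : ℝ) 0 with h | h | h
      · exact ⟨Sum.inl (Sum.inr (f₂.symm ⟨k, h⟩)), by simp [g]⟩
      · exact ⟨Sum.inr (f₃.symm ⟨k, h⟩), by simp [g]⟩
      · exact ⟨Sum.inl (Sum.inl (f₁.symm ⟨k, h⟩)), by simp [g]⟩
  let σ := Equiv.ofBijective g hg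
  let b₀ : Module.Basis (Fin (Module.finrank ℝ E)) ℝ E := Module.Basis.ofEquivFun e.toLinearEquiv
  have hQ' : ∀ v, B v v = ∑ i, (w i : ℝ) * (b₀.equivFun v i * b₀.equivFun v i) := by
    intro v
    have h1 : B v v = Q v := rfl
    rw [h1, ← e.map_app v, QuadraticMap.weightedSumSquares_apply]
    rfl
  have hpol : ∀ u v, B u v = ∑ i, (w i : ℝ) * (b₀.equivFun u i * b₀.equivFun v i) := by
    intro u v
    have h1 := hQ' (u + v)
    have h2 := hQ' u
    have h3 := hQ' v
    simp only [map_add, LinearMap.add_apply, Pi.add_apply] at h1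
    rw [h2, h3, hB v u] at h1
    have h4 : ∑ i, (w i : ℝ) * ((b₀.equivFun u i + b₀.equivFun v i) *
        (b₀.equivFun u i + b₀.equivFun v i)) =
        ∑ i, (w i : ℝ) * (b₀.equivFun u i * b₀.equivFun u i) +
        ∑ i, (w i : ℝ) * (b₀.equivFun v i * b₀.equivFun v i) +
        2 * ∑ i, (w i : ℝ) * (b₀.equivFun u i * b₀.equivFun v i) := by
      rw [Finset.mul_sum, ← Finset.sum_add_distrib, ← Finset.sum_add_distrib]
      exact Finset.sum_congr rfl fun i _ => by ring
    rw [h4] at h1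
    linarith
  refine ⟨b₀.reindex σ.symm, fun i j => ?_⟩
  rw [hpol, ← hwg]
  simp only [Module.Basis.reindex_apply, Equiv.symm_symm, Module.Basis.equivFun_self]
  rw [Finset.sum_eq_single (σ i)]
  · by_cases hij : i = j
    · subst hij; simp; rfl
    · have : σ j ≠ σ i := fun h => hij (σ.injective h.symm)
      simp [hij, this]
  · intro k _ hk
    simp [hk.symm]
  · simp

end Inertia

/-! ### The block description of 𝔬𝔣(B) and its semidirect decomposition. -/

section Structure

open Matrix DiagonalForm LieAlgebra

variable {E : Type*} [AddCommGroup E] [Module ℝ E] {ι : Type*} [Fintype ι] [DecidableEq ι] {r : ℕ}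
  {ε : ι → ℝ} {B : LinearMap.BilinForm ℝ E} {b : Module.Basis (ι ⊕ Fin r) ℝ E}

theorem bilinForm_eq_sum_of_basis
    (hb : ∀ i j, B (b i) (b j) = if i = j then Sum.elim ε (fun _ => 0) i else 0) (v w : E) :
    B v w = ∑ i, ε i * b.repr v (Sum.inl i) * b.repr w (Sum.inl i) := by
  have h : B v w = B (∑ i, b.repr v i • b i) (∑ j, b.repr w j • b j) := by
    rw [b.sum_repr, b.sum_repr]
  rw [h]
  simp only [map_sum, map_smul, LinearMap.sum_apply, LinearMap.smul_apply, hb, smul_eq_mul,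
    mul_ite, mul_zero, Finset.sum_ite_eq', Finset.mem_univ, if_true]
  rw [Fintype.sum_sum_type]
  simp only [Sum.elim_inl, Sum.elim_inr, mul_zero, Finset.sum_const_zero, add_zero]
  exact Finset.sum_congr rfl fun i _ => by ring

theorem mem_ker_iff_of_basis (hε : ∀ i, ε i * ε i = 1)
    (hb : ∀ i j, B (b i) (b j) = if i = j then Sum.elim ε (fun _ => 0) i else 0) (v : E) :
    v ∈ LinearMap.ker B ↔ ∀ i, b.repr v (Sum.inl i) = 0 := by
  rw [LinearMap.mem_ker]
  constructor
  · intro h i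
    have h1 : B v (b (Sum.inl i)) = 0 := by rw [h, LinearMap.zero_apply]
    rw [bilinForm_eq_sum_of_basis hb, Finset.sum_eq_single i
      (fun j _ hj => by simp [hj.symm]) (by simp)] at h1
    simp only [Module.Basis.repr_self, Finsupp.single_eq_same, mul_one] at h1
    linear_combination ε i * h1 - b.repr v (Sum.inl i) * hε i
  · intro h
    ext w
    rw [bilinForm_eq_sum_of_basis hb]
    simp [h]

theorem toLin_fromBlocks_mem_ofLie (hε : ∀ i, ε i * ε i = 1)
    (hb : ∀ i j, B (b i) (b j) = if i = j then Sum.elim ε (fun _ => 0) i else 0)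
    {A : Matrix ι ι ℝ} (hA : A ∈ skew ε) (C : Matrix (Fin r) ι ℝ) :
    Matrix.toLin b b (fromBlocks A 0 C 0) ∈ ofLie B := by
  have hrepr : ∀ v i, b.repr (Matrix.toLin b b (fromBlocks A 0 C 0) v) (Sum.inl i) =
      ∑ j, A i j * b.repr v (Sum.inl j) := by
    intro v i
    rw [Matrix.repr_toLin]
    simp [mulVec, dotProduct, Fintype.sum_sum_type]
  rw [mem_skew_iff] at hA
  refine ⟨fun v w => ?_, fun v hv => ?_⟩
  · rw [bilinForm_eq_sum_of_basis hb, bilinForm_eq_sum_of_basis hb]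
    simp only [hrepr, Finset.mul_sum, Finset.sum_mul]
    rw [Finset.sum_comm, ← Finset.sum_add_distrib]
    refine Finset.sum_eq_zero fun i _ => ?_
    rw [← Finset.sum_add_distrib]
    refine Finset.sum_eq_zero fun j _ => ?_
    linear_combination (b.repr v (Sum.inl i) * b.repr w (Sum.inl j)) * hA i j
  · rw [mem_ker_iff_of_basis hε hb] at hv
    rw [Matrix.toLin_apply_eq_zero_iff]
    rintro (i | i) <;> simp [mulVec, dotProduct, Fintype.sum_sum_type, hv]

/-- Vanishing on the kernel makes the right-hand blocks zero. The form ignores kernel coordinates,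
so skewness constrains only the upper left block. -/
theorem exists_fromBlocks_of_mem_ofLie (hε : ∀ i, ε i * ε i = 1)
    (hb : ∀ i j, B (b i) (b j) = if i = j then Sum.elim ε (fun _ => 0) i else 0)
    {X : Module.End ℝ E} (hX : X ∈ ofLie B) :
    ∃ A ∈ skew ε, ∃ C : Matrix (Fin r) ι ℝ, Matrix.toLin b b (fromBlocks A 0 C 0) = X := by
  set N := LinearMap.toMatrix b b X with hN
  have hNa : ∀ i j, N i j = b.repr (X (b j)) i := fun i j => LinearMap.toMatrix_apply _ _ _ _ _
  have h0 : ∀ i k, N i (Sum.inr k) = 0 := by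
    intro i k
    have : b (Sum.inr k) ∈ LinearMap.ker B := by
      rw [mem_ker_iff_of_basis hε hb]
      simp
    rw [hNa, hX.2 _ this, map_zero, Finsupp.zero_apply]
  refine ⟨N.toBlocks₁₁, ?_, N.toBlocks₂₁, ?_⟩
  · rw [mem_skew_iff]
    intro i j
    have h1 := hX.1 (b (Sum.inl j)) (b (Sum.inl i))
    rw [bilinForm_eq_sum_of_basis hb, bilinForm_eq_sum_of_basis hb] at h1
    rw [Finset.sum_eq_single i (fun j _ hj => by simp [hj.symm]) (by simp),
      Finset.sum_eq_single j (fun j _ hj => by simp [hj.symm]) (by simp)] at h1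
    simp only [Module.Basis.repr_self, Finsupp.single_eq_same, mul_one, ← hNa] at h1
    simp only [toBlocks₁₁, Matrix.of_apply]
    linarith
  · have : fromBlocks N.toBlocks₁₁ 0 N.toBlocks₂₁ 0 = N := by
      conv_rhs => rw [← fromBlocks_toBlocks N]
      congr 1
      · ext i k; exact (h0 _ _).symm
      · ext i k; exact (h0 _ _).symm
    rw [this, hN, Matrix.toLin_toMatrix]

/-- The lower left block associated with `r` vectors. -/
def lowerBlock (ε : ι → ℝ) : (Fin r → ι → ℝ) →ₗ[ℝ] Matrix (Fin r) ι ℝ where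
  toFun f := Matrix.of fun k j => ε j * f k j
  map_add' f g := by ext; simp [mul_add]
  map_smul' c f := by ext; simp [mul_left_comm]

omit [Fintype ι] [DecidableEq ι] in
theorem lowerBlock_apply (f : Fin r → ι → ℝ) (k : Fin r) (j : ι) :
    lowerBlock ε f k j = ε j * f k j := rfl

/-- The bracket with A acts on a lower left block C by -C A, the dual action on rows; rescaling
columns by ε turns it into the natural action on vectors. -/
theorem lowerBlock_mulVec {A : Matrix ι ι ℝ} (hA : A ∈ skew ε) (f : Fin r → ι → ℝ) :
    lowerBlock ε (fun k => A *ᵥ f k) = -(lowerBlock ε f * A) := by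
  rw [mem_skew_iff] at hA
  ext k j
  rw [lowerBlock_apply, Matrix.neg_apply, Matrix.mul_apply, mulVec, dotProduct, Finset.mul_sum,
    ← Finset.sum_neg_distrib]
  refine Finset.sum_congr rfl fun i _ => ?_
  rw [lowerBlock_apply]
  linear_combination f k i * hA j i

/-- The homomorphism from the semidirect sum to `𝔬𝔣(B)` defined by an adapted basis. -/
def semiDirectSumToOfLie (hε : ∀ i, ε i * ε i = 1)
    (hb : ∀ i j, B (b i) (b j) = if i = j then Sum.elim ε (fun _ => 0) i else 0) :
    SemiDirectSum (Fin r → ι → ℝ) (skew ε) (diagonalAction r (skew ε)) →ₗ⁅ℝ⁆ ofLie B where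
  toFun x := ⟨Matrix.toLin b b (fromBlocks x.right.1 0 (lowerBlock ε x.left) 0),
    toLin_fromBlocks_mem_ofLie hε hb x.right.2 _⟩
  map_add' x y := by
    apply Subtype.ext
    change _ = Matrix.toLin b b _ + Matrix.toLin b b _
    rw [← map_add, fromBlocks_add]
    simp
  map_smul' c x := by
    apply Subtype.ext
    change _ = c • Matrix.toLin b b _
    rw [← map_smul, fromBlocks_smul]
    simp
  map_lie' := by
    intro x y
    apply Subtype.ext
    change Matrix.toLin b b (fromBlocks (x.right.1 * y.right.1 - y.right.1 * x.right.1) 0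
      (lowerBlock ε (⁅x.left, y.left⁆ + (fun k => x.right.1 *ᵥ y.left k) -
        fun k => y.right.1 *ᵥ x.left k)) 0) =
      Matrix.toLin b b _ * Matrix.toLin b b _ - Matrix.toLin b b _ * Matrix.toLin b b _
    have h4 : ⁅x.left, y.left⁆ = 0 := by rw [Ring.lie_def, mul_comm, sub_self]
    rw [h4, zero_add, map_sub, lowerBlock_mulVec x.right.2, lowerBlock_mulVec y.right.2]
    simp only [Module.End.mul_eq_comp, ← Matrix.toLin_mul b b b, fromBlocks_multiply]
    rw [← map_sub]
    congr 1
    rw [sub_eq_add_neg (fromBlocks _ _ _ _), fromBlocks_neg, fromBlocks_add]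
    congr 1
    · simp [sub_eq_add_neg]
    · simp
    · simp [sub_eq_add_neg, add_comm]
    · simp

theorem semiDirectSumToOfLie_bijective (hε : ∀ i, ε i * ε i = 1)
    (hb : ∀ i j, B (b i) (b j) = if i = j then Sum.elim ε (fun _ => 0) i else 0) :
    Function.Bijective (semiDirectSumToOfLie hε hb) := by
  constructor
  · intro x y hxy
    have h1 := (Matrix.toLin b b).injective (congrArg Subtype.val hxy)
    obtain ⟨h2, -, h3, -⟩ := fromBlocks_inj.mp h1
    ext k j
    · have h5 := congrFun (congrFun h3 k) j
      rw [lowerBlock_apply, lowerBlock_apply] at h5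
      exact mul_left_cancel₀ (fun h => by simpa [h] using hε j) h5
    · exact congrFun (congrFun h2 k) j
  · rintro ⟨X, hX⟩
    obtain ⟨A, hA, C, rfl⟩ := exists_fromBlocks_of_mem_ofLie hε hb hX
    refine ⟨⟨fun k j => ε j * C k j, ⟨A, hA⟩⟩, Subtype.ext ?_⟩
    change Matrix.toLin b b (fromBlocks A 0 (lowerBlock ε _) 0) = _
    congr 2
    ext k j
    rw [lowerBlock_apply, ← mul_assoc, hε, one_mul]

end Structure

/-- Four distinct indices exhausting the index set force p + q = 4, hence (p, q) = (3, 1), with a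
single negative sign. -/
theorem signs_mul_eq_neg_one {p q : ℕ} (h : 1 ≤ q ∧ (3 ≤ p ∨ p = 2 ∧ q = 1))
    (i j k l : Fin p ⊕ Fin q) (hij : i ≠ j) (hkl : k ≠ l) (hki : k ≠ i) (hkj : k ≠ j) (hli : l ≠ i)
    (hlj : l ≠ j) (hall : ∀ m, m = i ∨ m = j ∨ m = k ∨ m = l) :
    signs p q i * signs p q j * (signs p q k * signs p q l) = -1 := by
  have huniv : (Finset.univ : Finset (Fin p ⊕ Fin q)) = {i, j, k, l} := by
    ext m; simpa using hall m
  have hi : i ∉ ({j, k, l} : Finset (Fin p ⊕ Fin q)) := by simp [hij, hki.symm, hli.symm]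
  have hj : j ∉ ({k, l} : Finset (Fin p ⊕ Fin q)) := by simp [hkj.symm, hlj.symm]
  have hk : k ∉ ({l} : Finset (Fin p ⊕ Fin q)) := by simpa using hkl
  have hcard : p + q = 4 := by
    have := congrArg Finset.card huniv
    rw [Finset.card_insert_of_notMem hi, Finset.card_insert_of_notMem hj,
      Finset.card_insert_of_notMem hk, Finset.card_singleton, Finset.card_univ] at this
    simpa using this
  obtain rfl : q = 1 := by omega
  have hprod : ∏ m, signs p 1 m = -1 := by simp [signs]
  rw [huniv, Finset.prod_insert hi, Finset.prod_insert hj, Finset.prod_insert hk,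
    Finset.prod_singleton] at hprod
  rw [← hprod, mul_assoc]

end

theorem mainTheorem10 {S W : Type*} [Fintype S] [DecidableEq S] [Group W]
    (M : CoxeterMatrix S) (_cs : CoxeterSystem M W) (hirr : M.IsIrreducible)
    (hfin : ¬ Finite W) (haff : ¬ IsAffineGroup W)
    (p q r : ℕ) (hp : p = sigPos (LinearMap.BilinMap.toQuadraticMap M.titsForm))
    (hq : q = sigNeg (LinearMap.BilinMap.toQuadraticMap M.titsForm))
    (hr : r = Module.finrank ℝ (LinearMap.ker M.titsForm)) :
    Nonempty (ofLie M.titsForm ≃ₗ⁅ℝ⁆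
      LieAlgebra.SemiDirectSum (Fin r → Fin p ⊕ Fin q → ℝ)
        (LieAlgebra.Orthogonal.so' (Fin p) (Fin q) ℝ)
        (diagonalAction r (LieAlgebra.Orthogonal.so' (Fin p) (Fin q) ℝ))) ∧
    LieAlgebra.IsSimple ℝ (LieAlgebra.Orthogonal.so' (Fin p) (Fin q) ℝ) ∧
    LieModule.IsIrreducible ℝ (LieAlgebra.Orthogonal.so' (Fin p) (Fin q) ℝ)
      (Fin p ⊕ Fin q → ℝ) ∧
    ¬ LieIsPresentableByProduct ℝ (ofLie M.titsForm) := by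
  have hsig : 1 ≤ q ∧ (3 ≤ p ∨ p = 2 ∧ q = 1) := by
    have := _cs.signature_bounds hirr hfin haff
    rwa [← hp, ← hq] at this
  obtain ⟨b, hb⟩ := exists_basis_signs M.titsForm M.titsForm_comm hp hq hr
  have hcard : 3 ≤ Fintype.card (Fin p ⊕ Fin q) := by
    rw [Fintype.card_sum, Fintype.card_fin, Fintype.card_fin]
    omega
  -- By definition `so'` is the algebra of skew-adjoint matrices of the indefinite diagonal matrix,
  -- which unfolds to `skew (signs p q)`.
  have hsimple : LieAlgebra.IsSimple ℝ (LieAlgebra.Orthogonal.so' (Fin p) (Fin q) ℝ) :=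
    DiagonalForm.isSimple_skew signs_mul_self hcard (signs_mul_eq_neg_one hsig)
  let e : ofLie M.titsForm ≃ₗ⁅ℝ⁆ LieAlgebra.SemiDirectSum (Fin r → Fin p ⊕ Fin q → ℝ)
      (LieAlgebra.Orthogonal.so' (Fin p) (Fin q) ℝ)
      (diagonalAction r (LieAlgebra.Orthogonal.so' (Fin p) (Fin q) ℝ)) :=
    (LieEquiv.ofBijective _ (semiDirectSumToOfLie_bijective signs_mul_self hb)).symm
  refine ⟨⟨e⟩, hsimple, DiagonalForm.isIrreducible_skew signs_mul_self hcard, fun h => ?_⟩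
  exact not_lieIsPresentableByProduct_semiDirectSum hsimple
    (fun v hv => DiagonalForm.eq_zero_of_forall_mulVec_eq_zero signs_mul_self hcard hv)
    (h.of_equiv e)
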